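/- Let $\Gamma$ be a finite simple graph. Its chromatic polynomial $P_\Gamma(x)$ is the polynomial whose value at each positive integer $k$ is the number of proper $k$-colorings of $\Gamma$. For a group $G$ of automorphisms of $\Gamma$, the orbital chromatic polynomial $OP_{\Gamma,G}(x)$ is the polynomial whose value at each positive integer $k$ is the number of orbits of $G$ on the set of proper $k$-colorings of $\Gamma$. The graph $\Gamma$ is outerplanar if it can be drawn in the plane without crossings (with edges drawn as polygonal arcs) so that every vertex lies on the boundary of the outer (unbounded) face. Theorem 1.3. Let $\Gamma$ be an outerplanar finite simple graph containing at least one odd cycle, and let $G$ be any group of automorphisms of $\Gamma$. Then the largest real root of $P_\Gamma(x)$ is $2$, and every real root of $OP_{\Gamma,G}(x)$ is at most $2$; that is, the real roots of $OP_{\Gamma,G}(x)$ are bounded above by the largest real root of $P_\Gamma(x)$. -/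

import Mathlib

open Polynomial

namespace SimpleGraph

/-! ### Orbits of colorings, chromatic and orbital chromatic polynomials -/

section Coloring

/-- The automorphism group of a graph acts on its proper colorings by `(g • c) v = c (g⁻¹ v)`;
subgroups of the automorphism group act by restriction. -/
instance coloringMulAction {V : Type*} (Γ : SimpleGraph V) (α : Type*) :
    MulAction (Γ ≃g Γ) (Γ.Coloring α) where
  smul g c := c.comp (g⁻¹ : Γ ≃g Γ).toHom
  one_smul _ := rfl
  mul_smul g h c := by
    refine RelHom.ext fun v => ?_
    change c ((g * h)⁻¹ v) = c (h⁻¹ (g⁻¹ v))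
    rw [mul_inv_rev]; rfl

theorem coloring_smul_apply {V : Type*} {Γ : SimpleGraph V} {α : Type*} (g : Γ ≃g Γ)
    (c : Γ.Coloring α) (v : V) : (g • c) v = c (g⁻¹ v) := rfl

/-- The number of maps `W → Fin k` which separate all `R`-related pairs is a polynomial in `k`. -/
theorem exists_polynomial_card_separating {W : Type*} [Finite W] (R : W → W → Prop) :
    ∃ P : ℝ[X], ∀ k : ℕ,
      P.eval (k : ℝ) = Nat.card {c : W → Fin k // ∀ a b, R a b → c a ≠ c b} := by
  classical
  have : Fintype W := Fintype.ofFinite W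
  have hS : Finite (Setoid W) :=
    Finite.of_injective (fun s : Setoid W => (s : W → W → Prop))
      (fun s t h => Setoid.ext fun a b => by rw [show (s : W → W → Prop) = t from h])
  let T := {s : Setoid W // ∀ a b, R a b → ¬ s a b}
  have : Fintype T := Fintype.ofFinite T
  refine ⟨∑ s : T, descPochhammer ℝ (Fintype.card (Quotient s.1)), fun k => ?_⟩
  let F : (Σ s : T, (Quotient s.1 ↪ Fin k)) → {c : W → Fin k // ∀ a b, R a b → c a ≠ c b} :=
    fun p => ⟨fun w => p.2 (Quotient.mk _ w), fun a b hab h =>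
      p.1.2 a b hab (Quotient.exact (p.2.injective h))⟩
  have hF : Function.Bijective F := by
    constructor
    · rintro ⟨⟨s, hs⟩, f⟩ ⟨⟨t, ht⟩, f'⟩ h
      have h1 : ∀ w, f (Quotient.mk _ w) = f' (Quotient.mk _ w) :=
        fun w => congrFun (congrArg Subtype.val h) w
      have hst : s = t := by
        refine Setoid.ext fun a b => ⟨fun hab => ?_, fun hab => ?_⟩
        · refine Quotient.exact (f'.injective ?_)
          rw [← h1, ← h1, Quotient.sound hab]
        · refine Quotient.exact (f.injective ?_)
          rw [h1, h1, Quotient.sound hab]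
      subst hst
      have : f = f' := by
        ext x
        induction x using Quotient.inductionOn with
        | h w => rw [h1]
      rw [this]
    · rintro ⟨c, hc⟩
      refine ⟨⟨⟨Setoid.ker c, fun a b hab h => hc a b hab h⟩,
        ⟨Quotient.lift c fun _ _ h => h, ?_⟩⟩, rfl⟩
      intro x y
      induction x, y using Quotient.inductionOn₂ with
      | h a b => exact fun h => Quotient.sound h
  rw [← Nat.card_congr (Equiv.ofBijective F hF), Nat.card_sigma, eval_finsetSum, Nat.cast_sum]
  refine Finset.sum_congr rfl fun s _ => ?_
  rw [Nat.card_eq_fintype_card, Fintype.card_embedding_eq, Fintype.card_fin,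
    descPochhammer_eval_eq_descFactorial]

/-- A polynomial is determined by its values at the positive integers. -/
theorem polynomial_eq_of_eval_nat {P Q : ℝ[X]}
    (h : ∀ k : ℕ, 0 < k → P.eval (k : ℝ) = Q.eval (k : ℝ)) : P = Q := by
  refine eq_of_infinite_eval_eq P Q (Set.Infinite.mono ?_
    ((Set.infinite_range_of_injective
      (f := fun n : ℕ => ((n + 1 : ℕ) : ℝ)) (fun a b hab => by simpa using hab))))
  rintro _ ⟨n, rfl⟩
  exact h (n + 1) n.succ_pos

theorem existsUnique_chromaticPolynomial {V : Type*} [Finite V] (Γ : SimpleGraph V) :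
    ∃! P : ℝ[X], ∀ k : ℕ, 0 < k → P.eval (k : ℝ) = Nat.card (Γ.Coloring (Fin k)) := by
  obtain ⟨P, hP⟩ := exists_polynomial_card_separating Γ.Adj
  have hP' : ∀ k : ℕ, 0 < k → P.eval (k : ℝ) = Nat.card (Γ.Coloring (Fin k)) := by
    intro k _
    rw [hP k]
    congr 1
    exact Nat.card_congr
      { toFun := fun c => Coloring.mk c.1 (fun {a b} hab => c.2 a b hab)
        invFun := fun c => ⟨c, fun _ _ hab => c.valid hab⟩
        left_inv := fun _ => rfl
        right_inv := fun _ => rfl }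
  exact ⟨P, hP', fun Q hQ => polynomial_eq_of_eval_nat fun k hk => by rw [hQ k hk, hP' k hk]⟩

/-- The chromatic polynomial `P_Γ`: the polynomial whose value at every positive integer `k`
is the number of proper `k`-colorings of `Γ`. -/
noncomputable def chromaticPolynomial {V : Type*} [Finite V] (Γ : SimpleGraph V) : ℝ[X] :=
  (existsUnique_chromaticPolynomial Γ).choose

theorem chromaticPolynomial_eval {V : Type*} [Finite V] (Γ : SimpleGraph V) (k : ℕ) (hk : 0 < k) :
    Γ.chromaticPolynomial.eval (k : ℝ) = Nat.card (Γ.Coloring (Fin k)) :=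
  (existsUnique_chromaticPolynomial Γ).choose_spec.1 k hk

theorem existsUnique_orbitalChromaticPolynomial {V : Type*} [Finite V] (Γ : SimpleGraph V)
    (G : Subgroup (Γ ≃g Γ)) :
    ∃! P : ℝ[X], ∀ k : ℕ, 0 < k →
      P.eval (k : ℝ) = Nat.card (MulAction.orbitRel.Quotient G (Γ.Coloring (Fin k))) := by
  classical
  have : Fintype V := Fintype.ofFinite V
  have : Finite (Γ ≃g Γ) := Finite.of_injective (fun g : Γ ≃g Γ => (g : V → V))
    (fun g h hgh => RelIso.ext fun v => congrFun hgh v)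
  have : Fintype G := Fintype.ofFinite G
  have key : ∀ g : G, ∃ P : ℝ[X], ∀ k : ℕ,
      P.eval (k : ℝ) = Nat.card (MulAction.fixedBy (Γ.Coloring (Fin k)) g) := by
    intro g
    let r : V → V → Prop := fun v w => g.1⁻¹ v = w
    obtain ⟨P, hP⟩ := exists_polynomial_card_separating (W := Quot r)
      (fun a b => ∃ v w, Quot.mk r v = a ∧ Quot.mk r w = b ∧ Γ.Adj v w)
    refine ⟨P, fun k => ?_⟩
    rw [hP k]
    congr 1
    refine Nat.card_congr
      { toFun := fun c => ⟨Coloring.mk (fun v => c.1 (Quot.mk r v))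
            (fun {a b} hab => c.2 _ _ ⟨a, b, rfl, rfl, hab⟩), ?_⟩
        invFun := fun c => ⟨Quot.lift c.1 ?_, ?_⟩
        left_inv := ?_
        right_inv := fun _ => rfl }
    · refine RelHom.ext fun v => ?_
      exact congrArg c.1 (Quot.sound (r := r) (a := v) (b := g.1⁻¹ v) rfl).symm
    · rintro v w rfl
      exact (DFunLike.congr_fun c.2 v).symm
    · rintro _ _ ⟨v, w, rfl, rfl, hvw⟩
      exact c.1.valid hvw
    · rintro ⟨c, hc⟩
      refine Subtype.ext (funext fun x => ?_)
      induction x using Quot.ind with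
      | mk v => rfl
  choose P hP using key
  have hQ : ∀ k : ℕ, 0 < k → (C (Fintype.card G : ℝ)⁻¹ * ∑ g, P g).eval (k : ℝ) =
      Nat.card (MulAction.orbitRel.Quotient G (Γ.Coloring (Fin k))) := by
    intro k _
    have : Fintype (MulAction.orbitRel.Quotient G (Γ.Coloring (Fin k))) := Fintype.ofFinite _
    have hb := MulAction.sum_card_fixedBy_eq_card_orbits_mul_card_group G (Γ.Coloring (Fin k))
    have hG : (Fintype.card G : ℝ) ≠ 0 := by exact_mod_cast Fintype.card_ne_zero
    rw [eval_mul, eval_C, eval_finsetSum, Nat.card_eq_fintype_card]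
    simp only [hP, Nat.card_eq_fintype_card]
    rw [← Nat.cast_sum, hb, Nat.cast_mul]
    field_simp
  exact ⟨_, hQ, fun Q' hQ' => polynomial_eq_of_eval_nat fun k hk => by rw [hQ' k hk, hQ k hk]⟩

/-- The orbital chromatic polynomial `OP_{Γ,G}`: the polynomial whose value at every positive
integer `k` is the number of orbits of `G` on the proper `k`-colorings of `Γ`. -/
noncomputable def orbitalChromaticPolynomial {V : Type*} [Finite V] (Γ : SimpleGraph V)
    (G : Subgroup (Γ ≃g Γ)) : ℝ[X] :=
  (existsUnique_orbitalChromaticPolynomial Γ G).choose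

theorem orbitalChromaticPolynomial_eval {V : Type*} [Finite V] (Γ : SimpleGraph V)
    (G : Subgroup (Γ ≃g Γ)) (k : ℕ) (hk : 0 < k) :
    (Γ.orbitalChromaticPolynomial G).eval (k : ℝ) =
      Nat.card (MulAction.orbitRel.Quotient G (Γ.Coloring (Fin k))) :=
  (existsUnique_orbitalChromaticPolynomial Γ G).choose_spec.1 k hk

end Coloring

/-! ### Outerplanar graphs -/

/-- `A` is a polygonal arc in the plane with ends `p` and `q`: the union of the segments
`[c 0, c 1], …, [c (n-1), c n]` with `c 0 = p` and `c n = q`, where consecutive segments meet only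
in their common end and all other pairs of segments are disjoint. -/
def IsPolygonalArc (p q : ℝ × ℝ) (A : Set (ℝ × ℝ)) : Prop :=
  ∃ (n : ℕ) (c : ℕ → ℝ × ℝ),
    c 0 = p ∧ c n = q ∧
    (∀ i < n, c i ≠ c (i + 1)) ∧
    (∀ i, i + 1 < n →
      segment ℝ (c i) (c (i + 1)) ∩ segment ℝ (c (i + 1)) (c (i + 2)) = {c (i + 1)}) ∧
    (∀ i j, i + 1 < j → j < n →
      Disjoint (segment ℝ (c i) (c (i + 1))) (segment ℝ (c j) (c (j + 1)))) ∧
    A = ⋃ i ∈ Set.Iio n, segment ℝ (c i) (c (i + 1))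

/-- A drawing of `Γ` in the plane without crossings (as usual, edges are drawn as polygonal arcs):
vertices are distinct points, each edge is an arc joining its two ends and containing no other
vertex, and two different edges meet at most in common ends. -/
structure PlaneDrawing {V : Type*} (Γ : SimpleGraph V) where
  /-- the point representing a vertex -/
  pos : V → ℝ × ℝ
  pos_injective : Function.Injective pos
  /-- the arc representing an edge (irrelevant for pairs that are not edges) -/
  arc : Sym2 V → Set (ℝ × ℝ)
  isPolygonalArc : ∀ u v, Γ.Adj u v → IsPolygonalArc (pos u) (pos v) (arc s(u, v))
  mem_of_pos_mem_arc : ∀ e ∈ Γ.edgeSet, ∀ w, pos w ∈ arc e → w ∈ e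
  arc_inter_arc : ∀ e ∈ Γ.edgeSet, ∀ f ∈ Γ.edgeSet, e ≠ f →
    arc e ∩ arc f ⊆ pos '' {v | v ∈ e ∧ v ∈ f}

/-- The set of points of the plane covered by the drawing. -/
def PlaneDrawing.support {V : Type*} {Γ : SimpleGraph V} (D : Γ.PlaneDrawing) : Set (ℝ × ℝ) :=
  Set.range D.pos ∪ ⋃ e ∈ Γ.edgeSet, D.arc e

/-- The outer face: the unbounded connected component of the complement of the drawing. -/
def PlaneDrawing.outerFace {V : Type*} {Γ : SimpleGraph V} (D : Γ.PlaneDrawing) : Set (ℝ × ℝ) :=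
  {x | x ∈ D.supportᶜ ∧ ¬ Bornology.IsBounded (connectedComponentIn D.supportᶜ x)}

/-- A graph is outerplanar if it can be drawn in the plane without crossings in such a way that
every vertex lies on the boundary of the outer face. -/
def IsOuterplanar {V : Type*} (Γ : SimpleGraph V) : Prop :=
  ∃ D : Γ.PlaneDrawing, ∀ v, D.pos v ∈ frontier D.outerFace

end SimpleGraph

/-! An odd cycle excludes 2-colorings, so 2 is a root of the chromatic polynomial. Everything else
follows from positivity of both polynomials on (2, ∞). By orbit counting, the orbital polynomial is
the average over g ∈ G of the polynomials counting the colorings fixed by g. Such colorings are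
proper colorings of the quotient of Γ by the cycles of g, and there are none if an edge lies in a
cycle. So it suffices that the quotients without loops have positive chromatic polynomials beyond 2;
the identity gives a strictly positive term.

This is proved in a weighted form (`weightPolynomial_eval_pos`), by induction on the number of
fibres, keeping a drawing of the graph upstairs rather than of its quotient. Some vertex upstairs
has degree at most two; by transitivity so does its whole fibre x, and x has at most two neighbours
in the quotient. Summing over the color of x leaves a factor q, q - 1 + α or q - 2 + α + β, where α,
β ≥ 0 are edge weights, and in the last case puts a new nonnegative weight on the pair of
neighbours. The factor is positive for q > 2, which is where the bound 2 comes from. Upstairs the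
fibre is suppressed and its neighbours are joined, which preserves the drawing (`exists_suppress`).

The vertex of degree at most two (`exists_degree_le_two`) comes from two facts. If all degrees are
at least three, rotating a longest path produces a cycle with two crossing chords, a subdivided
complete graph on four vertices. Such a graph cannot be drawn with its four branch vertices on the
outer boundary: each triangle would have winding number zero around the fourth vertex, and comparing
these windings near one vertex contradicts the fact that π is not a multiple of 2π. -/

open Filter Topology Bornology

/-! ### Arcs in the plane and the angles under which they are seen -/

namespace PlaneArc

/-- The plane `ℝ × ℝ` as the complex numbers. -/
noncomputable def toComplex : (ℝ × ℝ) ≃L[ℝ] ℂ := Complex.equivRealProdCLM.symm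

/-- Simple arcs from `p` to `q` built by joining segments that only meet where they are joined. -/
inductive SimpleArc : ℝ × ℝ → ℝ × ℝ → Set (ℝ × ℝ) → Prop
  | segment {p q : ℝ × ℝ} (h : p ≠ q) : SimpleArc p q (segment ℝ p q)
  | trans {p q r : ℝ × ℝ} {A B : Set (ℝ × ℝ)} (hA : SimpleArc p q A) (hB : SimpleArc q r B)
      (h : A ∩ B ⊆ {q}) : SimpleArc p r (A ∪ B)

namespace SimpleArc

variable {p q r : ℝ × ℝ} {A B : Set (ℝ × ℝ)}

theorem left_mem (h : SimpleArc p q A) : p ∈ A := by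
  induction h with
  | segment h => exact left_mem_segment _ _ _
  | trans _ _ _ ihA _ => exact Or.inl ihA

theorem right_mem (h : SimpleArc p q A) : q ∈ A := by
  induction h with
  | segment h => exact right_mem_segment _ _ _
  | trans _ _ _ _ ihB => exact Or.inr ihB

theorem ne (h : SimpleArc p q A) : p ≠ q := by
  induction h with
  | segment h => exact h
  | trans hA hB h ihA ihB =>
    rintro rfl
    exact ihA (h ⟨hA.left_mem, hB.right_mem⟩)

theorem left_notMem (hA : SimpleArc p q A) (h : A ∩ B ⊆ {q}) : p ∉ B := fun hp =>
  hA.ne (h ⟨hA.left_mem, hp⟩)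

theorem symm (h : SimpleArc p q A) : SimpleArc q p A := by
  induction h with
  | segment h => rw [segment_symm]; exact .segment h.symm
  | trans hA hB h ihA ihB =>
    rw [Set.union_comm]
    exact .trans ihB ihA (by rwa [Set.inter_comm])

theorem isClosed (h : SimpleArc p q A) : IsClosed A := by
  induction h with
  | segment h =>
    rw [segment_eq_image_lineMap]
    exact (isCompact_Icc.image AffineMap.lineMap_continuous).isClosed
  | trans _ _ _ ihA ihB => exact ihA.union ihB

theorem isPreconnected (h : SimpleArc p q A) : IsPreconnected A := by
  induction h with
  | segment h => exact (convex_segment _ _).isPreconnected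
  | trans hA hB _ ihA ihB => exact ihA.union _ hA.right_mem hB.left_mem ihB

/-- A winding number known at the far end `q` can thus be carried along the arc to points
arbitrarily close to `p`. -/
theorem isPreconnected_diff (h : SimpleArc p q A) : IsPreconnected (A \ {p}) := by
  induction h with
  | @segment p q h =>
    have : _root_.segment ℝ p q \ {p} = AffineMap.lineMap (k := ℝ) p q '' Set.Ioc (0 : ℝ) 1 := by
      rw [segment_eq_image_lineMap]
      ext z
      constructor
      · rintro ⟨⟨t, ht, rfl⟩, hz⟩
        refine ⟨t, ⟨lt_of_le_of_ne ht.1 ?_, ht.2⟩, rfl⟩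
        rintro rfl
        exact hz (by simp)
      · rintro ⟨t, ht, rfl⟩
        refine ⟨⟨t, ⟨ht.1.le, ht.2⟩, rfl⟩, fun hz => ?_⟩
        have : AffineMap.lineMap (k := ℝ) p q t = AffineMap.lineMap (k := ℝ) p q (0 : ℝ) := by
          simpa using hz
        exact ht.1.ne' (AffineMap.lineMap_injective ℝ h this)
    rw [this]
    exact isPreconnected_Ioc.image _ AffineMap.lineMap_continuous.continuousOn
  | @trans p q r A B hA hB h ihA ihB =>
    have hp : p ∉ B := hA.left_notMem h
    have : (A ∪ B) \ {p} = A \ {p} ∪ B := by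
      rw [Set.union_sdiff_distrib, Set.sdiff_singleton_eq_self hp]
    rw [this]
    exact IsPreconnected.union q ⟨hA.right_mem, hA.ne.symm⟩ hB.left_mem ihA hB.isPreconnected

end SimpleArc

/-- If the ratio were real and nonpositive, `p` and `q` would lie on opposite sides of `z` on a
line. Hence the principal argument is continuous off the segment. -/
theorem ratio_mem_slitPlane {p q z : ℝ × ℝ} (hz : z ∉ segment ℝ p q) :
    (toComplex q - toComplex z) / (toComplex p - toComplex z) ∈ Complex.slitPlane := by
  rw [Complex.mem_slitPlane_iff_not_le_zero]
  intro hle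
  obtain ⟨hre, him⟩ := Complex.le_def.1 hle
  set w := (toComplex q - toComplex z) / (toComplex p - toComplex z) with hw
  have hp : toComplex p - toComplex z ≠ 0 := by
    rw [sub_ne_zero]
    intro h
    rw [← toComplex.injective h] at hz
    exact hz (left_mem_segment _ _ _)
  have hwr : w = ((w.re : ℝ) : ℂ) := Complex.ext rfl (by simpa using him)
  have hre' : 0 ≤ -w.re := by simpa using hre
  have h1 : toComplex q - toComplex z = (w.re : ℂ) * (toComplex p - toComplex z) := by
    rw [← hwr, hw]; field_simp
  have h2 : q - z = w.re • (p - z) := by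
    apply toComplex.injective
    rw [map_smul, map_sub, map_sub, h1, Complex.real_smul]
  refine hz ⟨-w.re / (1 - w.re), 1 / (1 - w.re), by apply div_nonneg <;> linarith,
    by apply div_nonneg <;> linarith, ?_, ?_⟩
  · have : 1 - w.re ≠ 0 := by linarith
    field_simp; ring
  · have h3 : (1 - w.re) ≠ 0 := by linarith
    have h4 : q = z + w.re • (p - z) := by rw [← h2]; abel
    rw [h4]
    ext <;> simp <;> field_simp <;> ring

/-- `f z` is a total angle under which the arc `A` from `p` to `q` is seen from `z ∉ A`. -/
structure IsAngle (p q : ℝ × ℝ) (A : Set (ℝ × ℝ)) (f : ℝ × ℝ → ℝ) : Prop where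
  continuousOn : ContinuousOn f Aᶜ
  coe_eq : ∀ z ∉ A, (f z : Real.Angle) =
    (toComplex q - toComplex z).arg - (toComplex p - toComplex z).arg
  tendsto : Tendsto f (cobounded _) (𝓝 0)
  /-- behaviour near the initial point -/
  left : ∃ d : ℝ × ℝ, d ≠ 0 ∧ (∀ᶠ ε in 𝓝[>] (0 : ℝ), p + ε • d ∈ A) ∧
    ∃ g : ℝ × ℝ → ℝ, ContinuousAt g p ∧ ∀ z ∉ A, f z =
      ((toComplex d + toComplex p - toComplex z) / (toComplex p - toComplex z)).arg + g z

theorem IsAngle.segment {p q : ℝ × ℝ} (h : p ≠ q) :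
    IsAngle p q (segment ℝ p q)
      (fun z => ((toComplex q - toComplex z) / (toComplex p - toComplex z)).arg) where
  continuousOn z hz := by
    have hp : toComplex p - toComplex z ≠ 0 := by
      rw [sub_ne_zero]
      intro h
      rw [← toComplex.injective h] at hz
      exact hz (left_mem_segment _ _ _)
    refine ContinuousAt.continuousWithinAt (ContinuousAt.comp
      (f := fun z => (toComplex q - toComplex z) / (toComplex p - toComplex z))
      (Complex.continuousAt_arg (ratio_mem_slitPlane hz)) ?_)
    exact ContinuousAt.div (by fun_prop) (by fun_prop) hp
  coe_eq z hz := by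
    rw [Complex.arg_div_coe_angle]
    · rw [sub_ne_zero]
      intro h
      rw [← toComplex.injective h] at hz
      exact hz (right_mem_segment _ _ _)
    · rw [sub_ne_zero]
      intro h
      rw [← toComplex.injective h] at hz
      exact hz (left_mem_segment _ _ _)
  tendsto := by
    have h1 : Tendsto (fun z => toComplex p - toComplex z) (cobounded _) (cobounded ℂ) := by
      have := toComplex.antilipschitz.tendsto_cobounded
      have h2 : AntilipschitzWith 1 (fun z : ℂ => toComplex p - z) :=
        AntilipschitzWith.of_le_mul_dist fun x y => by simp [dist_eq_norm, norm_sub_rev x y]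
      exact h2.tendsto_cobounded.comp this
    have h2 : Tendsto (fun z => 1 + (toComplex q - toComplex p) * (toComplex p - toComplex z)⁻¹)
        (cobounded _) (𝓝 1) := by
      have := ((tendsto_inv₀_cobounded.comp h1).const_mul
        (toComplex q - toComplex p)).const_add 1
      simpa using this
    have h3 : Tendsto (fun z => (toComplex q - toComplex z) / (toComplex p - toComplex z))
        (cobounded _) (𝓝 1) := by
      refine h2.congr' ?_
      have : ∀ᶠ z in cobounded (ℝ × ℝ), toComplex p - toComplex z ≠ 0 :=
        h1.eventually_ne_cobounded 0
      filter_upwards [this] with z hz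
      field_simp
      ring
    have h4 := (Complex.continuousAt_arg Complex.one_mem_slitPlane).tendsto.comp h3
    rwa [Complex.arg_one] at h4
  left := by
    -- A single segment is its own initial segment, so no continuous correction is needed.
    refine ⟨q - p, sub_ne_zero.2 h.symm, ?_, fun _ => 0, continuousAt_const, fun z _ => ?_⟩
    · have : ∀ᶠ ε in 𝓝[>] (0 : ℝ), ε < 1 := nhdsWithin_le_nhds (gt_mem_nhds one_pos)
      filter_upwards [this, self_mem_nhdsWithin] with ε h1 h0
      rw [segment_eq_image']
      exact ⟨ε, ⟨le_of_lt h0, h1.le⟩, rfl⟩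
    · simp

/-- Angles add along joined arcs. Only `A` passes through `p`, so the angle of `B` goes into the
term that is continuous at `p`. -/
theorem IsAngle.trans {p q r : ℝ × ℝ} {A B : Set (ℝ × ℝ)} {f f' : ℝ × ℝ → ℝ}
    (hf : IsAngle p q A f) (hf' : IsAngle q r B f') (hB : IsClosed B) (hp : p ∉ B) :
    IsAngle p r (A ∪ B) (fun z => f z + f' z) where
  continuousOn := by
    rw [Set.compl_union]
    exact (hf.continuousOn.mono Set.inter_subset_left).add
      (hf'.continuousOn.mono Set.inter_subset_right)
  coe_eq z hz := by
    rw [Real.Angle.coe_add, hf.coe_eq z fun h => hz (.inl h), hf'.coe_eq z fun h => hz (.inr h)]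
    abel
  tendsto := by simpa using hf.tendsto.add hf'.tendsto
  left := by
    obtain ⟨d, hd, hA, g, hg, h⟩ := hf.left
    refine ⟨d, hd, hA.mono fun _ => Or.inl, fun z => g z + f' z, hg.add ?_, fun z hz => ?_⟩
    · exact hf'.continuousOn.continuousAt (hB.isOpen_compl.mem_nhds hp)
    · rw [h z fun h => hz (.inl h), add_assoc]

theorem SimpleArc.exists_isAngle {p q : ℝ × ℝ} {A : Set (ℝ × ℝ)} (h : SimpleArc p q A) :
    ∃ f, IsAngle p q A f := by
  induction h with
  | segment h => exact ⟨_, .segment h⟩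
  | trans hA hB h ihA ihB =>
    obtain ⟨f, hf⟩ := ihA
    obtain ⟨f', hf'⟩ := ihB
    exact ⟨_, hf.trans hf' hB.isClosed (hA.left_notMem h)⟩

/-- `T` takes values in 2πℤ; to leave 0 it would have to pass through π or -π. -/
theorem eq_zero_of_isPreconnected {S : Set (ℝ × ℝ)} (hS : IsPreconnected S) {T : ℝ × ℝ → ℝ}
    (hT : ContinuousOn T S) (h : ∀ z ∈ S, (T z : Real.Angle) = 0) {x y : ℝ × ℝ} (hx : x ∈ S)
    (hy : y ∈ S) (h0 : |T x| < Real.pi) : T y = 0 := by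
  have hpi := Real.pi_pos
  have hO := (hS.image T hT).ordConnected
  have key : ∀ t, |t| < 2 * Real.pi → (t : Real.Angle) = 0 → t = 0 := by
    intro t ht h
    obtain ⟨n, rfl⟩ := Real.Angle.coe_eq_zero_iff.1 h
    rw [zsmul_eq_mul, abs_mul, abs_of_pos Real.two_pi_pos] at ht
    have h1 : |(n : ℝ)| < 1 := by
      by_contra! h1
      nlinarith
    have h2 : |n| < 1 := by exact_mod_cast h1
    rw [Int.abs_lt_one_iff.1 h2]
    simp
  have hx0 : T x = 0 := key _ (by linarith) (h x hx)
  by_contra hne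
  have hpn : ∀ z ∈ S, |T z| ≠ Real.pi := by
    intro z hz hzp
    have := key _ (by rw [hzp]; linarith) (h z hz)
    rw [this, abs_zero] at hzp
    linarith
  have hbig : 2 * Real.pi ≤ |T y| := by
    by_contra! hlt
    exact hne (key _ hlt (h y hy))
  rcases le_abs.1 hbig with h1 | h1
  · obtain ⟨z, hz, hz'⟩ := hO.out (Set.mem_image_of_mem T hx) (Set.mem_image_of_mem T hy)
      (show Real.pi ∈ Set.Icc (T x) (T y) from ⟨by linarith, by linarith⟩)
    exact hpn z hz (by rw [hz', abs_of_pos hpi])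
  · obtain ⟨z, hz, hz'⟩ := hO.out (Set.mem_image_of_mem T hy) (Set.mem_image_of_mem T hx)
      (show -Real.pi ∈ Set.Icc (T y) (T x) from ⟨by linarith, by linarith⟩)
    exact hpn z hz (by rw [hz', abs_neg, abs_of_pos hpi])

/-- `p` is in the closure of the unbounded components of the complement of `S`. -/
def OnOuterBoundary (p : ℝ × ℝ) (S : Set (ℝ × ℝ)) : Prop :=
  p ∈ closure {x | ∃ K : Set (ℝ × ℝ), IsPreconnected K ∧ ¬ IsBounded K ∧ x ∈ K ∧ Disjoint K S}

theorem OnOuterBoundary.mono {p : ℝ × ℝ} {S S' : Set (ℝ × ℝ)} (h : OnOuterBoundary p S)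
    (hS : S' ⊆ S) : OnOuterBoundary p S' := by
  refine closure_mono ?_ h
  rintro x ⟨K, h1, h2, h3, h4⟩
  exact ⟨K, h1, h2, h3, h4.mono_right hS⟩

/-- A function counting turns around a closed curve `S` vanishes at points on the outer boundary
of a set containing `S`, if they are not on `S`. -/
theorem eq_zero_of_onOuterBoundary {S : Set (ℝ × ℝ)} (hS : IsClosed S) {T : ℝ × ℝ → ℝ}
    (hT : ContinuousOn T Sᶜ) (h : ∀ z ∉ S, (T z : Real.Angle) = 0)
    (hlim : Tendsto T (cobounded _) (𝓝 0)) {p : ℝ × ℝ} (hp : p ∉ S) (ho : OnOuterBoundary p S) :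
    T p = 0 := by
  have hpi := Real.pi_pos
  set U := {x | ∃ K : Set (ℝ × ℝ), IsPreconnected K ∧ ¬ IsBounded K ∧ x ∈ K ∧ Disjoint K S}
  have hU : ∀ x ∈ U, T x = 0 := by
    rintro x ⟨K, hK, hub, hxK, hd⟩
    have hKS : K ⊆ Sᶜ := hd.subset_compl_right
    have hev : ∀ᶠ z in cobounded (ℝ × ℝ), |T z| < Real.pi := by
      have := hlim.abs
      rw [abs_zero] at this
      exact this (gt_mem_nhds hpi)
    -- An unbounded set reaches the neighbourhood of infinity where `T` is small.
    have : ∃ z ∈ K, |T z| < Real.pi := by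
      by_contra! hcon
      refine hub (IsBounded.subset (t := {z | |T z| < Real.pi}ᶜ) (isBounded_def.2 ?_)
        fun z hz => not_lt.2 (hcon z hz))
      rw [compl_compl]
      exact hev
    obtain ⟨z, hz, hzT⟩ := this
    exact eq_zero_of_isPreconnected hK (hT.mono hKS) (fun z hz => h z (hKS hz)) hz hxK hzT
  have hc : ContinuousAt T p := hT.continuousAt (hS.isOpen_compl.mem_nhds hp)
  have := mem_closure_iff_nhdsWithin_neBot.1 ho
  have h1 : T p ∈ closure {(0 : ℝ)} :=
    mem_closure_of_tendsto (hc.tendsto.mono_left (nhdsWithin_le_nhds (s := U)))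
      (by filter_upwards [self_mem_nhdsWithin] with x hx using hU x hx)
  simpa using h1

/-- Three arcs joining `a`, `b` and `c` form a closed curve, which makes a whole number of turns
around every point outside of it. -/
theorem triangle_coe_eq_zero {a b c : ℝ × ℝ} {A B C : Set (ℝ × ℝ)} {f g h : ℝ × ℝ → ℝ}
    (hf : IsAngle a b A f) (hg : IsAngle b c B g) (hh : IsAngle a c C h) {z : ℝ × ℝ}
    (hz : z ∉ A ∪ B ∪ C) : ((f z + g z - h z : ℝ) : Real.Angle) = 0 := by
  rw [Real.Angle.coe_sub, Real.Angle.coe_add, hf.coe_eq z fun h => hz (.inl (.inl h)),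
    hg.coe_eq z fun h => hz (.inl (.inr h)), hh.coe_eq z fun h => hz (.inr h)]
  abel

/-- If `a`, `b`, `c` are joined by arcs and `d` is on the outer boundary then the closed curve
makes no turns around any point of a connected set through `d`. -/
theorem triangle_eq_zero {a b c d : ℝ × ℝ} {A B C K : Set (ℝ × ℝ)} {f g h : ℝ × ℝ → ℝ}
    (hf : IsAngle a b A f) (hg : IsAngle b c B g) (hh : IsAngle a c C h)
    (hA : IsClosed A) (hB : IsClosed B) (hC : IsClosed C) (hd : OnOuterBoundary d (A ∪ B ∪ C))
    (hK : IsPreconnected K) (hdK : d ∈ K) (hKA : Disjoint K (A ∪ B ∪ C)) {z : ℝ × ℝ}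
    (hz : z ∈ K) : f z + g z - h z = 0 := by
  have hcont : ContinuousOn (fun z => f z + g z - h z) (A ∪ B ∪ C)ᶜ := by
    refine ((hf.continuousOn.mono ?_).add (hg.continuousOn.mono ?_)).sub (hh.continuousOn.mono ?_)
      <;> intro x hx h <;> exact hx (by simp [h])
  have h0 : f d + g d - h d = 0 :=
    eq_zero_of_onOuterBoundary ((hA.union hB).union hC) hcont
      (fun z hz => triangle_coe_eq_zero hf hg hh hz)
      (by simpa using (hf.tendsto.add hg.tendsto).sub hh.tendsto)
      (Set.disjoint_left.1 hKA hdK) hd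
  refine eq_zero_of_isPreconnected hK (hcont.mono hKA.subset_compl_right)
    (fun z hz => triangle_coe_eq_zero hf hg hh (Set.disjoint_left.1 hKA hz)) hdK hz ?_
  rw [h0, abs_zero]
  exact Real.pi_pos

end PlaneArc

/-! ### The complete graph on four vertices has no outer drawing -/

namespace PlaneArc

/-- Directions of two arcs that leave a common point and do not meet again are different. -/
theorem neg_div_mem_slitPlane {a d d' : ℝ × ℝ} {A A' : Set (ℝ × ℝ)} (hd : d ≠ 0) (hd' : d' ≠ 0)
    (hA : ∀ᶠ ε in 𝓝[>] (0 : ℝ), a + ε • d ∈ A) (hA' : ∀ᶠ ε in 𝓝[>] (0 : ℝ), a + ε • d' ∈ A')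
    (h : A ∩ A' ⊆ {a}) : -toComplex d / toComplex d' ∈ Complex.slitPlane := by
  have hc : toComplex d ≠ 0 := by simpa using hd
  have hc' : toComplex d' ≠ 0 := by simpa using hd'
  rw [Complex.mem_slitPlane_iff_not_le_zero]
  intro hle
  obtain ⟨hre, him⟩ := Complex.le_def.1 hle
  set w := -toComplex d / toComplex d' with hw
  have hwr : w = ((w.re : ℝ) : ℂ) := Complex.ext rfl (by simpa using him)
  have h1 : toComplex d = ((-w.re : ℝ) : ℂ) * toComplex d' := by
    rw [Complex.ofReal_neg, ← hwr, hw]; field_simp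
  have h2 : d = (-w.re) • d' := by
    apply toComplex.injective
    rw [map_smul, h1, Complex.real_smul]
  have hpos : 0 < -w.re := by
    refine lt_of_le_of_ne (by simpa using hre) fun h0 => hd ?_
    rw [h2, ← h0, zero_smul]
  -- With `d` a positive multiple of `d'`, rescaling ε puts the same point, different from `a`, on
  -- both arcs.
  have h3 : Tendsto (fun ε : ℝ => ε * (-w.re)) (𝓝[>] 0) (𝓝[>] 0) := by
    refine tendsto_nhdsWithin_iff.2 ⟨?_, ?_⟩
    · have : Tendsto (fun ε : ℝ => ε * (-w.re)) (𝓝 0) (𝓝 (0 * (-w.re))) :=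
        (continuous_id.mul continuous_const).tendsto 0
      rw [zero_mul] at this
      exact this.mono_left nhdsWithin_le_nhds
    · filter_upwards [self_mem_nhdsWithin] with ε hε using mul_pos hε hpos
  obtain ⟨ε, h4, h5, h6⟩ :=
    (hA.and ((h3.eventually hA').and self_mem_nhdsWithin)).exists
  rw [h2, smul_smul] at h4
  have h7 := h ⟨h4, h5⟩
  have h8 : (ε * -w.re) • d' = 0 := by simpa using h7
  rcases smul_eq_zero.1 h8 with h9 | h9
  · exact (mul_pos h6 hpos).ne' h9
  · exact hd' h9

theorem tendsto_ray {a d : ℝ × ℝ} : Tendsto (fun ε : ℝ => a + ε • d) (𝓝[>] 0) (𝓝 a) := by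
  have : Tendsto (fun ε : ℝ => a + ε • d) (𝓝 0) (𝓝 (a + (0 : ℝ) • d)) :=
    (by fun_prop : Continuous fun ε : ℝ => a + ε • d).tendsto 0
  rw [zero_smul, add_zero] at this
  exact this.mono_left nhdsWithin_le_nhds

/-- The angle under which an initial segment in direction `d` is seen along a ray in another
direction. -/
theorem tendsto_arg_ray {a d d' : ℝ × ℝ} (hd' : d' ≠ 0)
    (h : -toComplex d / toComplex d' ∈ Complex.slitPlane) :
    Tendsto (fun ε : ℝ => ((toComplex d + toComplex a - toComplex (a + ε • d')) /
      (toComplex a - toComplex (a + ε • d'))).arg) (𝓝[>] 0)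
      (𝓝 (-toComplex d / toComplex d').arg) := by
  have hc' : toComplex d' ≠ 0 := by simpa using hd'
  have h1 : Tendsto (fun ε : ℝ => -toComplex d / toComplex d' + (ε : ℂ)) (𝓝[>] 0)
      (𝓝 (-toComplex d / toComplex d')) := by
    have : Tendsto (fun ε : ℝ => -toComplex d / toComplex d' + (ε : ℂ)) (𝓝 0)
      (𝓝 (-toComplex d / toComplex d' + ((0 : ℝ) : ℂ))) :=
      (by fun_prop : Continuous fun ε : ℝ => -toComplex d / toComplex d' + (ε : ℂ)).tendsto 0
    rw [Complex.ofReal_zero, add_zero] at this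
    exact this.mono_left nhdsWithin_le_nhds
  refine ((Complex.continuousAt_arg h).tendsto.comp h1).congr' ?_
  filter_upwards [self_mem_nhdsWithin] with ε hε
  have hε' : (0 : ℝ) < ε := hε
  have hε0 : (ε : ℂ) ≠ 0 := by exact_mod_cast hε'.ne'
  -- The positive factor ε⁻¹ does not change the argument.
  have : (toComplex d + toComplex a - toComplex (a + ε • d')) /
      (toComplex a - toComplex (a + ε • d')) =
      ((ε⁻¹ : ℝ) : ℂ) * (-toComplex d / toComplex d' + (ε : ℂ)) := by
    rw [map_add, map_smul, Complex.real_smul, Complex.ofReal_inv]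
    field_simp
    ring
  rw [this, Complex.arg_real_mul _ (inv_pos.2 hε'), Function.comp]

theorem arg_neg_div_swap {x y : ℂ} (hx : x ≠ 0) (hy : y ≠ 0) (h : -x / y ∈ Complex.slitPlane) :
    (-y / x).arg = -(-x / y).arg := by
  have : -y / x = (-x / y)⁻¹ := by field_simp
  rw [this, Complex.arg_inv, if_neg (Complex.mem_slitPlane_iff_arg.1 h).1]

/-- Modulo 2π the arguments of `x`, `y`, `z` cancel and the three signs contribute 3π, that is π. -/
theorem arg_cycle_ne_zero {x y z : ℂ} (hx : x ≠ 0) (hy : y ≠ 0) (hz : z ≠ 0) :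
    (-x / y).arg + (-y / z).arg + (-z / x).arg ≠ 0 := by
  intro h
  have h1 : (((-x / y).arg + (-y / z).arg + (-z / x).arg : ℝ) : Real.Angle) = 0 := by
    rw [h, Real.Angle.coe_zero]
  rw [Real.Angle.coe_add, Real.Angle.coe_add,
    Complex.arg_div_coe_angle (neg_ne_zero.2 hx) hy, Complex.arg_div_coe_angle (neg_ne_zero.2 hy) hz,
    Complex.arg_div_coe_angle (neg_ne_zero.2 hz) hx, Complex.arg_neg_coe_angle hx,
    Complex.arg_neg_coe_angle hy, Complex.arg_neg_coe_angle hz] at h1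
  have h2 : (Real.pi : Real.Angle) + Real.pi + Real.pi = 0 := by
    rw [← h1]; abel
  rw [Real.Angle.coe_pi_add_coe_pi, zero_add] at h2
  exact Real.Angle.pi_ne_zero h2

/-- The complete graph on four vertices cannot be drawn in the plane with all vertices on the
outer boundary. -/
theorem not_exists_completeGraph_four_drawing {a b c d : ℝ × ℝ}
    {AB AC AD BC CD BD : Set (ℝ × ℝ)}
    (hAB : SimpleArc a b AB) (hAC : SimpleArc a c AC) (hAD : SimpleArc a d AD)
    (hBC : SimpleArc b c BC) (hCD : SimpleArc c d CD) (hBD : SimpleArc b d BD)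
    (hABC : AB ∩ AC ⊆ {a}) (hACD : AC ∩ AD ⊆ {a}) (hABD : AB ∩ AD ⊆ {a})
    (h₁ : Disjoint AB CD) (h₂ : Disjoint AC BD) (h₃ : Disjoint AD BC)
    (ha : OnOuterBoundary a (AB ∪ AC ∪ AD ∪ BC ∪ CD ∪ BD))
    (hb : OnOuterBoundary b (AB ∪ AC ∪ AD ∪ BC ∪ CD ∪ BD))
    (hc : OnOuterBoundary c (AB ∪ AC ∪ AD ∪ BC ∪ CD ∪ BD))
    (hd : OnOuterBoundary d (AB ∪ AC ∪ AD ∪ BC ∪ CD ∪ BD)) : False := by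
  obtain ⟨fab, hab⟩ := hAB.exists_isAngle
  obtain ⟨fac, hac⟩ := hAC.exists_isAngle
  obtain ⟨fad, had⟩ := hAD.exists_isAngle
  obtain ⟨fbc, hbc⟩ := hBC.exists_isAngle
  obtain ⟨fcd, hcd⟩ := hCD.exists_isAngle
  obtain ⟨fbd, hbd⟩ := hBD.exists_isAngle
  rw [Set.disjoint_left] at h₁ h₂ h₃
  have hACB : AC ∩ AB ⊆ {a} := by rwa [Set.inter_comm]
  have hADC : AD ∩ AC ⊆ {a} := by rwa [Set.inter_comm]
  have hADB : AD ∩ AB ⊆ {a} := by rwa [Set.inter_comm]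
  -- Triangle `bcd` avoids `a`, so its winding number can be taken at `a` itself; the other three
  -- triangles pass through `a` and need limits.
  have T₀ : fbc a + fcd a - fbd a = 0 := by
    refine triangle_eq_zero (K := {a}) hbc hcd hbd hBC.isClosed hCD.isClosed hBD.isClosed
      (ha.mono ?_) isPreconnected_singleton rfl ?_ rfl
    · intro x; simp only [Set.mem_union]; tauto
    · rw [Set.disjoint_singleton_left]
      rintro ((h | h) | h)
      exacts [h₃ hAD.left_mem h, h₁ hAB.left_mem h, h₂ hAC.left_mem h]
  have Td : ∀ z ∈ AD \ {a}, fab z + fbc z - fac z = 0 := by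
    intro z hz
    refine triangle_eq_zero hab hbc hac hAB.isClosed hBC.isClosed hAC.isClosed
      (hd.mono ?_) hAD.isPreconnected_diff ⟨hAD.right_mem, hAD.ne.symm⟩ ?_ hz
    · intro x; simp only [Set.mem_union]; tauto
    · rw [Set.disjoint_left]
      rintro x ⟨hx, hxa⟩ ((h | h) | h)
      exacts [hxa (hADB ⟨hx, h⟩), h₃ hx h, hxa (hADC ⟨hx, h⟩)]
  have Tb : ∀ z ∈ AB \ {a}, fac z + fcd z - fad z = 0 := by
    intro z hz
    refine triangle_eq_zero hac hcd had hAC.isClosed hCD.isClosed hAD.isClosed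
      (hb.mono ?_) hAB.isPreconnected_diff ⟨hAB.right_mem, hAB.ne.symm⟩ ?_ hz
    · intro x; simp only [Set.mem_union]; tauto
    · rw [Set.disjoint_left]
      rintro x ⟨hx, hxa⟩ ((h | h) | h)
      exacts [hxa (hABC ⟨hx, h⟩), h₁ hx h, hxa (hABD ⟨hx, h⟩)]
  have Tc : ∀ z ∈ AC \ {a}, fab z + fbd z - fad z = 0 := by
    intro z hz
    refine triangle_eq_zero hab hbd had hAB.isClosed hBD.isClosed hAD.isClosed
      (hc.mono ?_) hAC.isPreconnected_diff ⟨hAC.right_mem, hAC.ne.symm⟩ ?_ hz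
    · intro x; simp only [Set.mem_union]; tauto
    · rw [Set.disjoint_left]
      rintro x ⟨hx, hxa⟩ ((h | h) | h)
      exacts [hxa (hACB ⟨hx, h⟩), h₂ hx h, hxa (hACD ⟨hx, h⟩)]
  obtain ⟨u, hu, hu', gb, hgb, hfb⟩ := hab.left
  obtain ⟨v, hv, hv', gc, hgc, hfc⟩ := hac.left
  obtain ⟨w, hw, hw', gd, hgd, hfd⟩ := had.left
  have cu : toComplex u ≠ 0 := by simpa using hu
  have cv : toComplex v ≠ 0 := by simpa using hv
  have cw : toComplex w ≠ 0 := by simpa using hw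
  have suv := neg_div_mem_slitPlane hu hv hu' hv' hABC
  have svu := neg_div_mem_slitPlane hv hu hv' hu' hACB
  have svw := neg_div_mem_slitPlane hv hw hv' hw' hACD
  have swv := neg_div_mem_slitPlane hw hv hw' hv' hADC
  have suw := neg_div_mem_slitPlane hu hw hu' hw' hABD
  have swu := neg_div_mem_slitPlane hw hu hw' hu' hADB
  have cbc : ContinuousAt fbc a := hbc.continuousOn.continuousAt
    (hBC.isClosed.isOpen_compl.mem_nhds fun h => h₃ hAD.left_mem h)
  have ccd : ContinuousAt fcd a := hcd.continuousOn.continuousAt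
    (hCD.isClosed.isOpen_compl.mem_nhds fun h => h₁ hAB.left_mem h)
  have cbd : ContinuousAt fbd a := hbd.continuousOn.continuousAt
    (hBD.isClosed.isOpen_compl.mem_nhds fun h => h₂ hAC.left_mem h)
  have mem_diff : ∀ {x : ℝ × ℝ} {X : Set (ℝ × ℝ)}, x ≠ 0 →
      (∀ᶠ ε in 𝓝[>] (0 : ℝ), a + ε • x ∈ X) → ∀ᶠ ε in 𝓝[>] (0 : ℝ), a + ε • x ∈ X \ {a} := by
    intro x X hx hX
    filter_upwards [hX, self_mem_nhdsWithin] with ε h1 h2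
    refine ⟨h1, fun h => ?_⟩
    have : ε • x = 0 := by simpa using h
    rcases smul_eq_zero.1 this with h | h
    exacts [(ne_of_gt h2) h, hx h]
  have lim : ∀ {x y : ℝ × ℝ} {X Y : Set (ℝ × ℝ)} {f g : ℝ × ℝ → ℝ}, y ≠ 0 →
      (∀ᶠ ε in 𝓝[>] (0 : ℝ), a + ε • y ∈ Y) →
      -toComplex x / toComplex y ∈ Complex.slitPlane → ContinuousAt g a → X ∩ Y ⊆ {a} →
      (∀ z ∉ X, f z =
        ((toComplex x + toComplex a - toComplex z) / (toComplex a - toComplex z)).arg + g z) →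
      Tendsto (fun ε : ℝ => f (a + ε • y)) (𝓝[>] 0)
        (𝓝 ((-toComplex x / toComplex y).arg + g a)) := by
    intro x y X Y f g hy hY hxy hg hXY hf
    refine ((tendsto_arg_ray (a := a) hy hxy).add (hg.tendsto.comp (tendsto_ray (d := y)))).congr' ?_
    filter_upwards [mem_diff hy hY] with ε hε
    rw [hf _ fun h => hε.2 (hXY ⟨h, hε.1⟩), Function.comp]
  have lim_const : ∀ {f : ℝ × ℝ → ℝ} {x : ℝ × ℝ}, ContinuousAt f a →
      Tendsto (fun ε : ℝ => f (a + ε • x)) (𝓝[>] 0) (𝓝 (f a)) :=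
    fun hf => hf.tendsto.comp tendsto_ray
  -- Let z tend to `a` along each of the three arcs leaving `a`, in the relation for the triangle
  -- formed by the other two.
  have Ld := tendsto_nhds_unique
    ((((lim hw hw' suw hgb hABD hfb).add (lim_const cbc)).sub (lim hw hw' svw hgc hACD hfc)).congr'
      ((mem_diff hw hw').mono fun ε hε => Td _ hε)) tendsto_const_nhds
  have Lb := tendsto_nhds_unique
    ((((lim hu hu' svu hgc hACB hfc).add (lim_const ccd)).sub (lim hu hu' swu hgd hADB hfd)).congr'
      ((mem_diff hu hu').mono fun ε hε => Tb _ hε)) tendsto_const_nhds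
  have Lc := tendsto_nhds_unique
    ((((lim hv hv' suv hgb hABC hfb).add (lim_const cbd)).sub (lim hv hv' swv hgd hADC hfd)).congr'
      ((mem_diff hv hv').mono fun ε hε => Tc _ hε)) tendsto_const_nhds
  have e1 := arg_neg_div_swap cu cv suv
  have e2 := arg_neg_div_swap cv cw svw
  have e3 := arg_neg_div_swap cu cw suw
  -- In `Ld + Lb - Lc` the continuous corrections cancel, and `T₀` removes the angles of the sides
  -- opposite `a`. By antisymmetry of the arguments, what remains is -2 times the cyclic sum.
  refine arg_cycle_ne_zero cu cv cw ?_
  rw [e1] at Lb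
  rw [e2] at Lc
  rw [e3] at Lb ⊢
  linarith

end PlaneArc

/-! ### Longest paths and cycles with crossing chords -/

namespace SimpleGraph

variable {V : Type*} {X : SimpleGraph V}

theorem exists_max_of_bounded {P : ℕ → Prop} {a B : ℕ} (ha : P a) (hB : ∀ n, P n → n ≤ B) :
    ∃ n, P n ∧ ∀ m, P m → m ≤ n := by
  classical
  exact ⟨Nat.findGreatest P B, Nat.findGreatest_spec (hB a ha) ha,
    fun m hm => Nat.le_findGreatest (hB m hm) hm⟩

/-- `w 0, …, w k` are the vertices of a path. -/
def IsPathSeq (X : SimpleGraph V) (k : ℕ) (w : ℕ → V) : Prop :=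
  Set.InjOn w (Set.Iic k) ∧ ∀ t < k, X.Adj (w t) (w (t + 1))

theorem IsPathSeq.inj {k : ℕ} {w : ℕ → V} (hw : X.IsPathSeq k w) {s t : ℕ} (hs : s ≤ k)
    (ht : t ≤ k) (h : w s = w t) : s = t := hw.1 hs ht h

theorem IsPathSeq.le_card [Finite V] {k : ℕ} {w : ℕ → V} (hw : X.IsPathSeq k w) :
    k ≤ Nat.card V := by
  have : Function.Injective (fun t : Fin (k + 1) => w t) := fun s t h =>
    Fin.ext (hw.inj (Nat.lt_succ_iff.1 s.2) (Nat.lt_succ_iff.1 t.2) h)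
  have := Nat.card_le_card_of_injective _ this
  rw [Nat.card_fin] at this
  omega

theorem IsPathSeq.cons {k : ℕ} {w : ℕ → V} (hw : X.IsPathSeq k w) {z : V} (hz : X.Adj (w 0) z)
    (hz' : ∀ t ≤ k, z ≠ w t) : X.IsPathSeq (k + 1) (fun t => if t = 0 then z else w (t - 1)) := by
  refine ⟨fun s hs t ht h => ?_, fun t ht => ?_⟩
  · simp only [Set.mem_Iic] at hs ht
    dsimp only at h
    split_ifs at h with h1 h2 h2
    · omega
    · exact absurd h (hz' _ (by omega))
    · exact absurd h.symm (hz' _ (by omega))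
    · have := hw.inj (by omega) (by omega) h
      omega
  · rcases Nat.eq_zero_or_pos t with rfl | h
    · simpa using hz.symm
    · have := hw.2 (t - 1) (by omega)
      rw [Nat.sub_add_cancel h] at this
      simpa [h.ne'] using this

/-- Pósa rotation: the initial part before `w i` is reversed, so the path starts at `w (i - 1)`,
keeps its length and uses the edge from `w 0` to `w i`. -/
theorem IsPathSeq.rotate {k i : ℕ} {w : ℕ → V} (hw : X.IsPathSeq k w) (hi : i ≤ k)
    (h : X.Adj (w 0) (w i)) :
    X.IsPathSeq k (fun t => if t < i then w (i - 1 - t) else w t) := by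
  refine ⟨fun s hs t ht h => ?_, fun t ht => ?_⟩
  · simp only [Set.mem_Iic] at hs ht
    dsimp only at h
    split_ifs at h with h1 h2 h2 <;> have := hw.inj (by omega) (by omega) h <;> omega
  · dsimp only
    split_ifs with h1 h2 h2
    · have := hw.2 (i - 1 - (t + 1)) (by omega)
      rw [show i - 1 - (t + 1) + 1 = i - 1 - t by omega] at this
      exact this.symm
    · rw [show i - 1 - t = 0 by omega, show t + 1 = i by omega]
      exact h
    · omega
    · exact hw.2 t ht

/-- The same cycle, traversed backwards from `c (i - 1)`: through `c 0`, then `c J`, and down to `c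
i`. -/
theorem IsPathSeq.reverse_cycle {J i : ℕ} {c : ℕ → V} (hc : X.IsPathSeq J c)
    (hcJ : X.Adj (c J) (c 0)) (hi : i ≤ J) (hi0 : 1 ≤ i) :
    X.IsPathSeq J (fun t => if t < i then c (i - 1 - t) else c (J + i - t)) ∧
      X.Adj (if J < i then c (i - 1 - J) else c (J + i - J))
        (if 0 < i then c (i - 1 - 0) else c (J + i - 0)) := by
  refine ⟨⟨fun s hs t ht h => ?_, fun t ht => ?_⟩, ?_⟩
  · simp only [Set.mem_Iic] at hs ht
    dsimp only at h
    split_ifs at h with h1 h2 h2 <;> have := hc.inj (by omega) (by omega) h <;> omega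
  · dsimp only
    split_ifs with h1 h2 h2
    · have := hc.2 (i - 1 - (t + 1)) (by omega)
      rw [show i - 1 - (t + 1) + 1 = i - 1 - t by omega] at this
      exact this.symm
    · rw [show i - 1 - t = 0 by omega, show J + i - (t + 1) = J by omega]
      exact hcJ.symm
    · omega
    · have := hc.2 (J + i - (t + 1)) (by omega)
      rw [show J + i - (t + 1) + 1 = J + i - t by omega] at this
      exact this.symm
  · rw [if_neg (by omega), if_pos (by omega), show J + i - J = i - 1 + 1 by omega]
    exact (hc.2 (i - 1) (by omega)).symm

/-- A finite graph without vertices of degree at most two has a cycle with two crossing chords. -/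
theorem exists_cycle_crossing_chords [Finite V] [Nonempty V]
    (hX : ∀ v a b, ∃ z, X.Adj v z ∧ z ≠ a ∧ z ≠ b) :
    ∃ (c : ℕ → V) (J i m : ℕ), X.IsPathSeq J c ∧ X.Adj (c J) (c 0) ∧ 2 ≤ i ∧ i < m ∧ m ≤ J ∧
      X.Adj (c 0) (c i) ∧ X.Adj (c (i - 1)) (c m) := by
  obtain ⟨v₀⟩ := ‹Nonempty V›
  obtain ⟨K, ⟨w₀, hw₀⟩, hK⟩ := exists_max_of_bounded (P := fun k => ∃ w, X.IsPathSeq k w) (a := 0)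
    (B := Nat.card V) ⟨fun _ => v₀, fun s hs t ht _ => by simp at hs ht; omega, by simp⟩
    (fun k ⟨w, hw⟩ => hw.le_card)
  have hN : ∀ w, X.IsPathSeq K w → ∀ z, X.Adj (w 0) z → ∃ t ≤ K, z = w t := by
    intro w hw z hz
    by_contra! hcon
    have := hK _ ⟨_, hw.cons hz hcon⟩
    omega
  obtain ⟨z₀, hz₀, -⟩ := hX (w₀ 0) v₀ v₀
  obtain ⟨t₀, ht₀, rfl⟩ := hN w₀ hw₀ z₀ hz₀
  -- `J` is maximal over all longest paths, not just one, so that the bound on the neighbours of the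
  -- initial vertex survives rotations.
  obtain ⟨J, ⟨hJK, w₁, hw₁, hwJ⟩, hJ⟩ := exists_max_of_bounded
    (P := fun j => j ≤ K ∧ ∃ w, X.IsPathSeq K w ∧ X.Adj (w 0) (w j)) (B := K)
    ⟨ht₀, w₀, hw₀, hz₀⟩ (fun j hj => hj.1)
  have hNJ : ∀ w, X.IsPathSeq K w → ∀ z, X.Adj (w 0) z → ∃ t ≤ J, 1 ≤ t ∧ z = w t := by
    intro w hw z hz
    obtain ⟨t, ht, rfl⟩ := hN w hw z hz
    refine ⟨t, hJ t ⟨ht, w, hw, hz⟩, ?_, rfl⟩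
    rcases Nat.eq_zero_or_pos t with rfl | h
    · exact absurd rfl hz.ne
    · exact h
  have key : ∀ (i : ℕ) (w c : ℕ → V), X.IsPathSeq K w → X.IsPathSeq J c → X.Adj (c J) (c 0) →
      (∀ t ≤ i, c t = w t) → (∀ t ≤ J, ∃ s ≤ J, w t = c s) → X.Adj (c 0) (c i) → 2 ≤ i → i < J →
      ∃ (c : ℕ → V) (J i m : ℕ), X.IsPathSeq J c ∧ X.Adj (c J) (c 0) ∧ 2 ≤ i ∧ i < m ∧ m ≤ J ∧
        X.Adj (c 0) (c i) ∧ X.Adj (c (i - 1)) (c m) := by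
    intro i
    induction i using Nat.strong_induction_on with
    | _ i ih =>
      intro w c hw hc hcJ hcw hset hi h2 hiJ
      have hwi : X.Adj (w 0) (w i) := by rwa [← hcw 0 (by omega), ← hcw i le_rfl]
      have hw' := hw.rotate (by omega) hwi
      obtain ⟨z, hz, hz1, hz2⟩ := hX (c (i - 1)) (c (i - 2)) (c i)
      have hset' : ∀ t ≤ J, ∃ s ≤ J, (if t < i then w (i - 1 - t) else w t) = c s := by
        intro t ht
        split_ifs
        · exact hset _ (by omega)
        · exact hset _ ht
      have hm : ∃ m ≤ J, z = c m := by
        obtain ⟨t, ht, -, h⟩ := hNJ _ hw' z (by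
          rw [if_pos (by omega), Nat.sub_zero, ← hcw _ (by omega)]; exact hz)
        rw [h]
        exact hset' t ht
      obtain ⟨m, hmJ, rfl⟩ := hm
      have hmi : m ≠ i := fun h => hz2 (by rw [h])
      have hmi2 : m ≠ i - 2 := fun h => hz1 (by rw [h])
      have hmi1 : m ≠ i - 1 := fun h => hz.ne (by rw [h])
      -- If m > i the two chords cross. Otherwise m ≤ i - 3, and seen from `c (i - 1)` on the
      -- reversed cycle the new chord has the smaller length i - 1 - m ≥ 2.
      rcases lt_or_gt_of_ne hmi with hlt | hgt
      · obtain ⟨hc', hcJ'⟩ := hc.reverse_cycle hcJ hiJ.le (by omega)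
        refine ih (i - 1 - m) (by omega) _ _ hw' hc' hcJ' ?_ ?_ ?_ (by omega) (by omega)
        · intro t ht
          rw [if_pos (by omega), if_pos (by omega), hcw _ (by omega)]
        · intro t ht
          obtain ⟨s, hs, h⟩ := hset' t ht
          rw [h]
          by_cases hsi : s < i
          · exact ⟨i - 1 - s, by omega, by rw [if_pos (by omega)]; congr 1; omega⟩
          · exact ⟨J + i - s, by omega, by rw [if_neg (by omega)]; congr 1; omega⟩
        · rw [if_pos (by omega), if_pos (by omega), Nat.sub_zero,
            show i - 1 - (i - 1 - m) = m by omega]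
          exact hz
      · exact ⟨c, J, i, m, hc, hcJ, h2, hgt, hmJ, hi, hz⟩
  obtain ⟨z, hz, hz1, hz2⟩ := hX (w₁ 0) (w₁ 1) (w₁ J)
  obtain ⟨i, hi, hi1, rfl⟩ := hNJ w₁ hw₁ z hz
  have h1 : i ≠ 1 := fun h => hz1 (by rw [h])
  have h2 : i ≠ J := fun h => hz2 (by rw [h])
  refine key i w₁ w₁ hw₁ ⟨hw₁.1.mono (Set.Iic_subset_Iic.2 hJK), fun t ht => hw₁.2 t (by omega)⟩
    hwJ.symm (fun _ _ => rfl) (fun t ht => ⟨t, ht, rfl⟩) hz (by omega) (by omega)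

end SimpleGraph

/-! ### Outer drawings: suppressing vertices, and a vertex of degree at most two -/

namespace SimpleGraph

open PlaneArc

/-- Segments are appended one at a time. Distinct ends exclude the polygonal arc with no segments,
which is empty. -/
theorem IsPolygonalArc.simpleArc {p q : ℝ × ℝ} {A : Set (ℝ × ℝ)} (h : IsPolygonalArc p q A)
    (hpq : p ≠ q) : SimpleArc p q A := by
  obtain ⟨n, c, rfl, rfl, hne, hcons, hdisj, rfl⟩ := h
  have hn : 1 ≤ n := by
    rcases Nat.eq_zero_or_pos n with rfl | h
    · exact absurd rfl hpq
    · exact h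
  have key : ∀ m, 1 ≤ m → m ≤ n →
      SimpleArc (c 0) (c m) (⋃ i ∈ Set.Iio m, segment ℝ (c i) (c (i + 1))) := by
    intro m hm
    induction m, hm using Nat.le_induction with
    | base =>
      intro _
      have : (⋃ i ∈ Set.Iio 1, segment ℝ (c i) (c (i + 1))) = segment ℝ (c 0) (c 1) := by
        ext x; simp
      rw [this]
      exact .segment (hne 0 (by omega))
    | succ m hm ih =>
      intro hmn
      have : (⋃ i ∈ Set.Iio (m + 1), segment ℝ (c i) (c (i + 1))) =
          (⋃ i ∈ Set.Iio m, segment ℝ (c i) (c (i + 1))) ∪ segment ℝ (c m) (c (m + 1)) := by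
        rw [← Order.succ_eq_add_one, Order.Iio_succ_eq_insert, Set.biUnion_insert, Set.union_comm]
        rfl
      rw [this]
      refine .trans (ih (by omega)) (.segment (hne m (by omega))) ?_
      rintro x ⟨hx, hx'⟩
      obtain ⟨i, hi, hxi⟩ := Set.mem_iUnion₂.1 hx
      simp only [Set.mem_Iio] at hi
      rcases Nat.lt_or_ge (i + 1) m with h | h
      · exact absurd hx' (Set.disjoint_left.1 (hdisj i m h (by omega)) hxi)
      · obtain rfl : m = i + 1 := by omega
        rw [← hcons i (by omega)]
        exact ⟨hxi, hx'⟩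
  exact key n hn le_rfl

variable {V : Type*} {X : SimpleGraph V}

/-- A drawing in the plane without crossings with all vertices on the outer boundary. -/
structure OuterDrawing (X : SimpleGraph V) where
  /-- the point representing a vertex -/
  pos : V → ℝ × ℝ
  /-- the arc representing an edge -/
  arc : Sym2 V → Set (ℝ × ℝ)
  pos_injective : Function.Injective pos
  simpleArc : ∀ u v, X.Adj u v → SimpleArc (pos u) (pos v) (arc s(u, v))
  arc_inter_arc : ∀ e ∈ X.edgeSet, ∀ f ∈ X.edgeSet, e ≠ f → ∀ x ∈ arc e, x ∈ arc f →
    ∃ v, v ∈ e ∧ v ∈ f ∧ pos v = x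
  onOuterBoundary : ∀ v, OnOuterBoundary (pos v) (⋃ e ∈ X.edgeSet, arc e)

theorem IsOuterplanar.nonempty_outerDrawing (h : X.IsOuterplanar) : Nonempty X.OuterDrawing := by
  obtain ⟨D, hD⟩ := h
  refine ⟨⟨D.pos, D.arc, D.pos_injective, fun u v huv => (D.isPolygonalArc u v huv).simpleArc
    fun h => huv.ne (D.pos_injective h), fun e he f hf hef x hx hx' => ?_, fun v => ?_⟩⟩
  · obtain ⟨v, hv, rfl⟩ := D.arc_inter_arc e he f hf hef ⟨hx, hx'⟩
    exact ⟨v, hv.1, hv.2, rfl⟩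
  · refine closure_mono ?_ (frontier_subset_closure (hD v))
    rintro x ⟨hx, hub⟩
    refine ⟨_, isPreconnected_connectedComponentIn, hub, mem_connectedComponentIn hx, ?_⟩
    refine Set.disjoint_left.2 fun y hy hy' => connectedComponentIn_subset _ _ hy (Or.inr hy')

namespace OuterDrawing

/-- Vertices with at most two neighbours can be removed from a drawing with all vertices on the
outer boundary, and their neighbours joined. -/
theorem exists_suppress (D : X.OuterDrawing) {p : V → Prop} (X' : SimpleGraph {v // p v})
    (hX' : ∀ a b, X'.Adj a b → X.Adj a b ∨ ∃ v, ¬ p v ∧ X.Adj v a ∧ X.Adj v b)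
    (hdeg : ∀ v, ¬ p v → ∃ a b, ∀ z, X.Adj v z → z = a ∨ z = b) : Nonempty X'.OuterDrawing := by
  classical
  have hvia : ∀ e : Sym2 {v // p v}, ∃ v : V, e ∈ X'.edgeSet → e.map Subtype.val ∉ X.edgeSet →
      ¬ p v ∧ ∀ w ∈ e, X.Adj v w := by
    intro e
    induction e using Sym2.ind with
    | _ a b =>
      by_cases h : X'.Adj a b
      · rcases hX' a b h with h1 | ⟨v, hv, ha, hb⟩
        · exact ⟨a, fun _ h2 => absurd h1 h2⟩
        · refine ⟨v, fun _ _ => ⟨hv, fun w hw => ?_⟩⟩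
          rcases Sym2.mem_iff.1 hw with rfl | rfl <;> assumption
      · exact ⟨a, fun h1 => absurd h1 h⟩
  choose via hvia using hvia
  -- An old edge keeps its arc; a new one is drawn along the two old edges at a removed vertex.
  let pieces : Sym2 {v // p v} → Set (Sym2 V) := fun e =>
    if e.map Subtype.val ∈ X.edgeSet then {e.map Subtype.val} else {f | ∃ w ∈ e, f = s(via e, ↑w)}
  have hpieces : ∀ e ∈ X'.edgeSet, ∀ f ∈ pieces e, f ∈ X.edgeSet := by
    intro e he f hf
    simp only [pieces] at hf
    split_ifs at hf with h
    · rw [hf]; exact h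
    · obtain ⟨w, hw, rfl⟩ := hf
      exact (hvia e he h).2 w hw
  have hmem : ∀ e ∈ X'.edgeSet, ∀ f ∈ pieces e, ∀ v (hv : p v), v ∈ f → ⟨v, hv⟩ ∈ e := by
    intro e he f hf v hv hvf
    simp only [pieces] at hf
    split_ifs at hf with h
    · rw [hf, Sym2.mem_map] at hvf
      obtain ⟨w, hw, rfl⟩ := hvf
      exact hw
    · obtain ⟨w, hw, rfl⟩ := hf
      rcases Sym2.mem_iff.1 hvf with rfl | rfl
      · exact absurd hv (hvia e he h).1
      · exact hw
  have hmem' : ∀ e ∈ X'.edgeSet, ∀ f ∈ pieces e, ∀ v, ¬ p v → v ∈ f → v = via e ∧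
      e.map Subtype.val ∉ X.edgeSet := by
    intro e he f hf v hv hvf
    simp only [pieces] at hf
    split_ifs at hf with h
    · rw [hf, Sym2.mem_map] at hvf
      obtain ⟨w, hw, rfl⟩ := hvf
      exact absurd w.2 hv
    · obtain ⟨w, hw, rfl⟩ := hf
      rcases Sym2.mem_iff.1 hvf with rfl | rfl
      · exact ⟨rfl, h⟩
      · exact absurd w.2 hv
  -- A removed vertex has at most two neighbours, so it serves at most one new edge. This is where
  -- the degree bound is used.
  have hcommon : ∀ e ∈ X'.edgeSet, ∀ e' ∈ X'.edgeSet, e ≠ e' → ∀ f ∈ pieces e, ∀ f' ∈ pieces e',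
      ∀ v ∈ f, v ∈ f' → p v := by
    intro e he e' he' hne f hf f' hf' v hv hv'
    by_contra hp
    obtain ⟨h1, h2⟩ := hmem' e he f hf v hp hv
    obtain ⟨h1', h2'⟩ := hmem' e' he' f' hf' v hp hv'
    apply hne
    obtain ⟨a, b, hab⟩ := hdeg v hp
    have h3 := (hvia e he h2).2
    have h3' := (hvia e' he' h2').2
    rw [← h1] at h3
    rw [← h1'] at h3'
    clear hv hv' hf hf' h1 h1' h2 h2' hne
    induction e using Sym2.ind with
    | _ x y =>
    induction e' using Sym2.ind with
    | _ x' y' =>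
      have hxy : (x : V) ≠ y := fun h => he.ne (Subtype.ext h)
      have hxy' : (x' : V) ≠ y' := fun h => he'.ne (Subtype.ext h)
      have e1 := hab _ (h3 x (Sym2.mem_mk_left _ _))
      have e2 := hab _ (h3 y (Sym2.mem_mk_right _ _))
      have e3 := hab _ (h3' x' (Sym2.mem_mk_left _ _))
      have e4 := hab _ (h3' y' (Sym2.mem_mk_right _ _))
      rw [Sym2.eq_iff, Subtype.ext_iff, Subtype.ext_iff, Subtype.ext_iff, Subtype.ext_iff]
      grind
  refine ⟨⟨fun v => D.pos v, fun e => ⋃ f ∈ pieces e, D.arc f,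
    fun a b h => Subtype.ext (D.pos_injective h), ?_, ?_, ?_⟩⟩
  · intro u v huv
    have he : s(u, v) ∈ X'.edgeSet := huv
    by_cases h : X.Adj u v
    · have : pieces s(u, v) = {s(↑u, ↑v)} := if_pos h
      rw [this, Set.biUnion_singleton]
      exact D.simpleArc _ _ h
    · have h1 : pieces s(u, v) = {f | ∃ w ∈ s(u, v), f = s(via s(u, v), ↑w)} := if_neg h
      have h2 : pieces s(u, v) = {s(↑u, via s(u, v)), s(via s(u, v), ↑v)} := by
        rw [h1]
        ext f
        simp only [Sym2.mem_iff, exists_eq_or_imp, exists_eq_left, Set.mem_ofPred_eq,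
          Set.mem_insert_iff, Set.mem_singleton_iff, Sym2.eq_swap (a := (u : V))]
      obtain ⟨hp, hadj⟩ := hvia _ he h
      have hu := hadj u (Sym2.mem_mk_left _ _)
      have hv := hadj v (Sym2.mem_mk_right _ _)
      rw [h2, Set.biUnion_pair]
      refine (D.simpleArc _ _ hu.symm).trans (D.simpleArc _ _ hv) ?_
      rintro x ⟨hx, hx'⟩
      have huv' : (u : V) ≠ v := fun h => huv.ne (Subtype.ext h)
      have hne := hu.ne
      obtain ⟨w, hw, hw', rfl⟩ := D.arc_inter_arc _ hu.symm _ hv (by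
        rw [Ne, Sym2.eq_iff]; grind) x hx hx'
      rcases Sym2.mem_iff.1 hw with rfl | rfl
      · rcases Sym2.mem_iff.1 hw' with h | h
        · exact absurd h.symm hne
        · exact absurd h huv'
      · rfl
  · intro e he e' he' hne x hx hx'
    obtain ⟨f, hf, hxf⟩ := Set.mem_iUnion₂.1 hx
    obtain ⟨f', hf', hxf'⟩ := Set.mem_iUnion₂.1 hx'
    -- A shared piece would have both ends kept, and these ends would determine both edges.
    have hff' : f ≠ f' := by
      rintro rfl
      have h1 := hpieces e he f hf
      have h2 := fun v hv => hcommon e he e' he' hne f hf f hf' v hv hv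
      have h3 := hmem e he f hf
      have h4 := hmem e' he' f hf'
      clear hxf hxf' hf hf'
      induction f using Sym2.ind with
      | _ a b =>
        have ha := h2 a (Sym2.mem_mk_left _ _)
        have hb := h2 b (Sym2.mem_mk_right _ _)
        have hab : (⟨a, ha⟩ : {v // p v}) ≠ ⟨b, hb⟩ := fun h => h1.ne (congrArg Subtype.val h)
        apply hne
        rw [(Sym2.mem_and_mem_iff hab).1 ⟨h3 a ha (Sym2.mem_mk_left _ _), h3 b hb (Sym2.mem_mk_right _ _)⟩,
          (Sym2.mem_and_mem_iff hab).1 ⟨h4 a ha (Sym2.mem_mk_left _ _), h4 b hb (Sym2.mem_mk_right _ _)⟩]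
    obtain ⟨v, hv, hv', rfl⟩ :=
      D.arc_inter_arc f (hpieces e he f hf) f' (hpieces e' he' f' hf') hff' x hxf hxf'
    have hp := hcommon e he e' he' hne f hf f' hf' v hv hv'
    exact ⟨⟨v, hp⟩, hmem e he f hf v hp hv, hmem e' he' f' hf' v hp hv', rfl⟩
  · intro v
    refine (D.onOuterBoundary v).mono ?_
    intro x hx
    obtain ⟨e, he, hx⟩ := Set.mem_iUnion₂.1 hx
    obtain ⟨f, hf, hx⟩ := Set.mem_iUnion₂.1 hx
    exact Set.mem_iUnion₂.2 ⟨f, hpieces e he f hf, hx⟩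

theorem simpleArc_path (D : X.OuterDrawing) {c : ℕ → V} {a b : ℕ} (hab : a < b)
    (hc : Set.InjOn c (Set.Icc a b)) (hadj : ∀ t, a ≤ t → t < b → X.Adj (c t) (c (t + 1))) :
    SimpleArc (D.pos (c a)) (D.pos (c b)) (⋃ t ∈ Set.Ico a b, D.arc s(c t, c (t + 1))) := by
  have hab' : a + 1 ≤ b := hab
  clear hab
  induction b, hab' using Nat.le_induction with
  | base =>
    have : (⋃ t ∈ Set.Ico a (a + 1), D.arc s(c t, c (t + 1))) = D.arc s(c a, c (a + 1)) := by
      have : Set.Ico a (a + 1) = {a} := by ext; simp; omega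
      rw [this, Set.biUnion_singleton]
    rw [this]
    exact D.simpleArc _ _ (hadj a le_rfl (by omega))
  | succ b hb ih =>
    have : (⋃ t ∈ Set.Ico a (b + 1), D.arc s(c t, c (t + 1))) =
        (⋃ t ∈ Set.Ico a b, D.arc s(c t, c (t + 1))) ∪ D.arc s(c b, c (b + 1)) := by
      have : Set.Ico a (b + 1) = insert b (Set.Ico a b) := by ext; simp; omega
      rw [this, Set.biUnion_insert, Set.union_comm]
    rw [this]
    refine (ih (hc.mono (Set.Icc_subset_Icc_right (by omega)))
      fun t h1 h2 => hadj t h1 (by omega)).trans (D.simpleArc _ _ (hadj b (by omega) (by omega))) ?_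
    rintro x ⟨hx, hx'⟩
    obtain ⟨t, ⟨ht1, ht2⟩, hxt⟩ := Set.mem_iUnion₂.1 hx
    have inj : ∀ {s t}, a ≤ s → s ≤ b + 1 → a ≤ t → t ≤ b + 1 → c s = c t → s = t :=
      fun h1 h2 h3 h4 h => hc ⟨h1, h2⟩ ⟨h3, h4⟩ h
    have hne : s(c t, c (t + 1)) ≠ s(c b, c (b + 1)) := by
      rw [Ne, Sym2.eq_iff]
      rintro (⟨h, h'⟩ | ⟨h, h'⟩)
      · have := inj ht1 (by omega) (by omega) (by omega) h
        omega
      · have := inj ht1 (by omega) (by omega) (by omega) h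
        omega
    obtain ⟨v, hv, hv', rfl⟩ := D.arc_inter_arc _ (hadj t ht1 (by omega)) _
      (hadj b (by omega) (by omega)) hne x hxt hx'
    rcases Sym2.mem_iff.1 hv' with rfl | rfl
    · rfl
    · rcases Sym2.mem_iff.1 hv with h | h
      · have := inj (by omega) (by omega) (by omega) (by omega) h
        omega
      · have := inj (by omega) (by omega) (by omega) (by omega) h
        omega

/-- A nonempty graph which can be drawn with all vertices on the outer boundary has a vertex of
degree at most two. -/
theorem exists_degree_le_two [Finite V] [Nonempty V] (D : X.OuterDrawing) :
    ∃ v a b, ∀ z, X.Adj v z → z = a ∨ z = b := by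
  by_contra! hX
  obtain ⟨c₀, J, i, m, hc₀, hcJ, h2, him, hmJ, hi, hm⟩ := exists_cycle_crossing_chords hX
  -- Index `J + 1` repeats vertex 0, so the path from `c m` back to `c 0` is nondegenerate even if
  -- `m = J`.
  obtain ⟨c, hc⟩ : ∃ c : ℕ → V, ∀ t, c t = if t ≤ J then c₀ t else c₀ 0 := ⟨_, fun _ => rfl⟩
  have hcl : ∀ {s t}, s ≤ J + 1 → t ≤ J + 1 → c s = c t →
      s = t ∨ (s = 0 ∧ t = J + 1) ∨ (s = J + 1 ∧ t = 0) := by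
    intro s t hs ht h
    rw [hc, hc] at h
    split_ifs at h with h1 h2 h2 <;> try have := hc₀.inj (by omega) (by omega) h
    all_goals omega
  have hadj : ∀ t < J + 1, X.Adj (c t) (c (t + 1)) := by
    intro t ht
    rw [hc, hc, if_pos (by omega)]
    split_ifs with h
    · exact hc₀.2 t (by omega)
    · obtain rfl : t = J := by omega
      exact hcJ
  have hJ0 : c (J + 1) = c 0 := by rw [hc, hc, if_neg (by omega), if_pos (by omega)]
  have hi' : X.Adj (c i) (c 0) := by
    rw [hc, hc, if_pos (by omega), if_pos (by omega)]; exact hi.symm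
  have hm' : X.Adj (c (i - 1)) (c m) := by
    rw [hc, hc, if_pos (by omega), if_pos (by omega)]; exact hm
  have hi1 : X.Adj (c i) (c (i - 1)) := by
    have := hadj (i - 1) (by omega)
    rw [Nat.sub_add_cancel (by omega)] at this
    exact this.symm
  have common : ∀ {s t s' t' : ℕ} {x : ℝ × ℝ}, X.Adj (c s) (c t) → X.Adj (c s') (c t') →
      x ∈ D.arc s(c s, c t) → x ∈ D.arc s(c s', c t') → s(c s, c t) ≠ s(c s', c t') →
      ∃ r r', (r = s ∨ r = t) ∧ (r' = s' ∨ r' = t') ∧ c r = c r' ∧ x = D.pos (c r) := by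
    intro s t s' t' x h h' hx hx' hne
    obtain ⟨v, hv, hv', rfl⟩ := D.arc_inter_arc _ h _ h' hne x hx hx'
    rcases Sym2.mem_iff.1 hv with rfl | rfl <;> rcases Sym2.mem_iff.1 hv' with h | h
    exacts [⟨_, _, .inl rfl, .inl rfl, h, rfl⟩, ⟨_, _, .inl rfl, .inr rfl, h, rfl⟩,
      ⟨_, _, .inr rfl, .inl rfl, h, rfl⟩, ⟨_, _, .inr rfl, .inr rfl, h, rfl⟩]
  -- Distinctness of edges is reduced to arithmetic of indices, with 0 and `J + 1` identified.
  have edge_ne : ∀ {s t s' t' : ℕ}, s ≤ J + 1 → t ≤ J + 1 → s' ≤ J + 1 → t' ≤ J + 1 →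
      ((s = s' ∨ (s = 0 ∧ s' = J + 1) ∨ (s = J + 1 ∧ s' = 0)) →
        ¬ (t = t' ∨ (t = 0 ∧ t' = J + 1) ∨ (t = J + 1 ∧ t' = 0))) →
      ((s = t' ∨ (s = 0 ∧ t' = J + 1) ∨ (s = J + 1 ∧ t' = 0)) →
        ¬ (t = s' ∨ (t = 0 ∧ s' = J + 1) ∨ (t = J + 1 ∧ s' = 0))) →
      s(c s, c t) ≠ s(c s', c t') := by
    intro s t s' t' h1 h2 h3 h4 h5 h6
    rw [Ne, Sym2.eq_iff]
    rintro (⟨h, h'⟩ | ⟨h, h'⟩)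
    · exact h5 (hcl h1 h3 h) (hcl h2 h4 h')
    · exact h6 (hcl h1 h4 h) (hcl h2 h3 h')
  have hinj : ∀ {a b}, b ≤ J + 1 → (0 < a ∨ b < J + 1) → Set.InjOn c (Set.Icc a b) := by
    rintro a b hb h s ⟨hs, hs'⟩ t ⟨ht, ht'⟩ hst
    have := hcl (by omega) (by omega) hst
    omega
  have path : ∀ {a b}, a < b → b ≤ J + 1 → (0 < a ∨ b < J + 1) → SimpleArc (D.pos (c a))
      (D.pos (c b)) (⋃ t ∈ Set.Ico a b, D.arc s(c t, c (t + 1))) := fun h1 h2 h3 =>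
    D.simpleArc_path h1 (hinj h2 h3) fun t _ ht => hadj t (by omega)
  have hsub : ∀ {a b}, b ≤ J + 1 → (⋃ t ∈ Set.Ico a b, D.arc s(c t, c (t + 1))) ⊆
      ⋃ e ∈ X.edgeSet, D.arc e := by
    intro a b hb x hx
    obtain ⟨t, ht, hx⟩ := Set.mem_iUnion₂.1 hx
    exact Set.mem_iUnion₂.2 ⟨_, hadj t (by have := ht.2; omega), hx⟩
  have hsub' : ∀ {s t}, X.Adj (c s) (c t) → D.arc s(c s, c t) ⊆ ⋃ e ∈ X.edgeSet, D.arc e :=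
    fun h x hx => Set.mem_iUnion₂.2 ⟨_, h, hx⟩
  have hCD := path (a := m) (b := J + 1) (by omega) le_rfl (by omega)
  rw [hJ0] at hCD
  have outer : ∀ v, OnOuterBoundary (D.pos v) (D.arc s(c i, c (i - 1)) ∪ D.arc s(c i, c 0) ∪
      (⋃ t ∈ Set.Ico i m, D.arc s(c t, c (t + 1))) ∪
      (⋃ t ∈ Set.Ico 0 (i - 1), D.arc s(c t, c (t + 1))) ∪
      (⋃ t ∈ Set.Ico m (J + 1), D.arc s(c t, c (t + 1))) ∪ D.arc s(c (i - 1), c m)) := by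
    intro v
    refine (D.onOuterBoundary v).mono ?_
    exact Set.union_subset (Set.union_subset (Set.union_subset (Set.union_subset (Set.union_subset
      (hsub' hi1) (hsub' hi')) (hsub (by omega))) (hsub (by omega))) (hsub (by omega))) (hsub' hm')
  -- The branch vertices a, b, c, d are `c i`, `c (i - 1)`, `c 0`, `c m`; AC and BD are the chords,
  -- and the other four arcs make up the cycle.
  refine not_exists_completeGraph_four_drawing (D.simpleArc _ _ hi1) (D.simpleArc _ _ hi')
    (path him (by omega) (by omega)) (path (a := 0) (b := i - 1) (by omega) (by omega) (by omega)).symm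
    hCD.symm (D.simpleArc _ _ hm') ?_ ?_ ?_ ?_ ?_ ?_ (outer _) (outer _) (outer _) (outer _)
  · rintro x ⟨hx, hx'⟩
    obtain ⟨r, r', h1, h1', h3, rfl⟩ := common hi1 hi' hx hx' (edge_ne (by omega) (by omega)
      (by omega) (by omega) (by omega) (by omega))
    have := hcl (by omega) (by omega) h3
    obtain rfl : r = i := by omega
    rfl
  · rintro x ⟨hx, hx'⟩
    obtain ⟨t, ⟨ht1, ht2⟩, hx'⟩ := Set.mem_iUnion₂.1 hx'
    obtain ⟨r, r', h1, h1', h3, rfl⟩ := common hi' (hadj t (by omega)) hx hx' (edge_ne (by omega)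
      (by omega) (by omega) (by omega) (by omega) (by omega))
    have := hcl (by omega) (by omega) h3
    obtain rfl : r = i := by omega
    rfl
  · rintro x ⟨hx, hx'⟩
    obtain ⟨t, ⟨ht1, ht2⟩, hx'⟩ := Set.mem_iUnion₂.1 hx'
    obtain ⟨r, r', h1, h1', h3, rfl⟩ := common hi1 (hadj t (by omega)) hx hx' (edge_ne (by omega)
      (by omega) (by omega) (by omega) (by omega) (by omega))
    have := hcl (by omega) (by omega) h3
    obtain rfl : r = i := by omega
    rfl
  · refine Set.disjoint_left.2 fun x hx hx' => ?_
    obtain ⟨t, ⟨ht1, ht2⟩, hx'⟩ := Set.mem_iUnion₂.1 hx'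
    obtain ⟨r, r', h1, h1', h3, -⟩ := common hi1 (hadj t (by omega)) hx hx' (edge_ne (by omega)
      (by omega) (by omega) (by omega) (by omega) (by omega))
    have := hcl (by omega) (by omega) h3
    omega
  · refine Set.disjoint_left.2 fun x hx hx' => ?_
    obtain ⟨r, r', h1, h1', h3, -⟩ := common hi' hm' hx hx' (edge_ne (by omega)
      (by omega) (by omega) (by omega) (by omega) (by omega))
    have := hcl (by omega) (by omega) h3
    omega
  · refine Set.disjoint_left.2 fun x hx hx' => ?_
    obtain ⟨s, ⟨hs1, hs2⟩, hx⟩ := Set.mem_iUnion₂.1 hx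
    obtain ⟨t, ⟨ht1, ht2⟩, hx'⟩ := Set.mem_iUnion₂.1 hx'
    obtain ⟨r, r', h1, h1', h3, -⟩ := common (hadj s (by omega)) (hadj t (by omega)) hx hx'
      (edge_ne (by omega) (by omega) (by omega) (by omega) (by omega) (by omega))
    have := hcl (by omega) (by omega) h3
    omega

end OuterDrawing

end SimpleGraph

/-! ### Weighted chromatic polynomials and elimination of a vertex -/

namespace SimpleGraph

section PartitionPolynomial

variable {W : Type*} [Finite W]

instance finite_setoid : Finite (Setoid W) :=
  Finite.of_injective (fun s : Setoid W => (s : W → W → Prop))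
    (fun s t h => Setoid.ext fun a b => by rw [show (s : W → W → Prop) = t from h])

noncomputable instance fintypeSetoid : Fintype (Setoid W) := Fintype.ofFinite _

/-- The polynomial with value `∑ c : W → Fin k, F (Setoid.ker c)` at `k`. -/
noncomputable def partitionPolynomial (F : Setoid W → ℝ) : ℝ[X] :=
  ∑ s : Setoid W, C (F s) * descPochhammer ℝ (Nat.card (Quotient s))

theorem partitionPolynomial_eval (F : Setoid W → ℝ) (q : ℝ) :
    (partitionPolynomial F).eval q =
      ∑ s, F s * (descPochhammer ℝ (Nat.card (Quotient s))).eval q := by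
  simp [partitionPolynomial, eval_finsetSum]

/-- A map to `Fin k` is a partition, its kernel, together with an injection of the quotient; falling
factorials count these injections. -/
theorem partitionPolynomial_eval_natCast [Fintype W] [DecidableEq W] (F : Setoid W → ℝ) (k : ℕ) :
    (partitionPolynomial F).eval (k : ℝ) = ∑ c : W → Fin k, F (Setoid.ker c) := by
  classical
  have (s : Setoid W) : Fintype (Quotient s) := Fintype.ofFinite _
  let E : (Σ s : Setoid W, (Quotient s ↪ Fin k)) → (W → Fin k) :=
    fun p w => p.2 (Quotient.mk _ w)
  have hker : ∀ p, Setoid.ker (E p) = p.1 := by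
    rintro ⟨s, f⟩
    refine Setoid.ext fun a b => ?_
    rw [Setoid.ker_def]
    exact ⟨fun h => Quotient.exact (f.injective h), fun h => congrArg f (Quotient.sound h)⟩
  have hE : Function.Bijective E := by
    constructor
    · rintro ⟨s, f⟩ ⟨t, f'⟩ h
      obtain rfl : s = t := by
        have := (hker ⟨s, f⟩).symm.trans ((congrArg Setoid.ker h).trans (hker ⟨t, f'⟩))
        exact this
      have : f = f' := by
        ext x
        induction x using Quotient.inductionOn with
        | h w => exact congrArg Fin.val (congrFun h w)
      rw [this]
    · intro c
      refine ⟨⟨Setoid.ker c, ⟨Quotient.lift c fun _ _ h => h, fun x y => ?_⟩⟩, rfl⟩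
      induction x, y using Quotient.inductionOn₂ with
      | h a b => exact fun h => Quotient.sound h
  rw [partitionPolynomial_eval, ← (Equiv.ofBijective E hE).sum_comp, Fintype.sum_sigma]
  refine Finset.sum_congr rfl fun s _ => ?_
  have : ∀ f : Quotient s ↪ Fin k, F (Setoid.ker (Equiv.ofBijective E hE ⟨s, f⟩)) = F s :=
    fun f => congrArg F (hker ⟨s, f⟩)
  simp only [this]
  rw [Finset.sum_const, Finset.card_univ, Fintype.card_embedding_eq, Fintype.card_fin,
    descPochhammer_eval_eq_descFactorial, nsmul_eq_mul, mul_comm, Nat.card_eq_fintype_card]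

open Classical in
/-- The product of the weights `y u w` over all pairs in a relation. -/
noncomputable def pairWeight (y : W → W → ℝ) (r : W → W → Prop) : ℝ :=
  letI := Fintype.ofFinite W
  ∏ u, ∏ w, if r u w then y u w else 1

theorem pairWeight_eq [Fintype W] (y : W → W → ℝ) (r : W → W → Prop) [DecidableRel r] :
    pairWeight y r = ∏ u, ∏ w, if r u w then y u w else 1 := by
  unfold pairWeight
  congr!

/-- The multivariate chromatic polynomial of a complete graph, with weight `y u w * y w u` on the
edge between `u` and `w`. -/
noncomputable def weightPolynomial (y : W → W → ℝ) : ℝ[X] :=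
  partitionPolynomial fun s => pairWeight y s

theorem weightPolynomial_of_isEmpty [IsEmpty W] (y : W → W → ℝ) : weightPolynomial y = 1 := by
  classical
  have : Fintype W := Fintype.ofFinite W
  refine polynomial_eq_of_eval_nat fun k _ => ?_
  rw [weightPolynomial, partitionPolynomial_eval_natCast]
  simp [pairWeight_eq]

-- Weight 0 kills every map that gives equal colors to a related pair, and weight 1 imposes nothing.
open Classical in
theorem weightPolynomial_indicator (R : W → W → Prop) (k : ℕ) :
    (weightPolynomial fun u w => if R u w then 0 else 1).eval (k : ℝ) =
      Nat.card {c : W → Fin k // ∀ a b, R a b → c a ≠ c b} := by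
  have : Fintype W := Fintype.ofFinite W
  rw [weightPolynomial, partitionPolynomial_eval_natCast, Nat.card_eq_fintype_card,
    Fintype.card_subtype, Finset.card_filter, Nat.cast_sum]
  refine Finset.sum_congr rfl fun c _ => ?_
  rw [pairWeight_eq]
  split_ifs with h
  · rw [Nat.cast_one]
    refine Finset.prod_eq_one fun u _ => Finset.prod_eq_one fun w _ => ?_
    split_ifs with h1 h2
    · exact absurd h1 (h u w h2)
    · rfl
    · rfl
  · push Not at h
    obtain ⟨a, b, hab, hc⟩ := h
    rw [Nat.cast_zero]
    refine Finset.prod_eq_zero (Finset.mem_univ a) (Finset.prod_eq_zero (Finset.mem_univ b) ?_)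
    rw [if_pos (show Setoid.ker c a b from hc), if_pos hab]

variable (x : W) (y : W → W → ℝ)

theorem pairWeight_split (r : W → W → Prop) [DecidableEq W] [DecidableRel r]
    [Fintype {w // w ≠ x}] (hx : r x x) :
    pairWeight y r = y x x * pairWeight (fun u w : {w // w ≠ x} => y u w) (fun u w => r u w) *
      ∏ u : {w // w ≠ x}, ((if r x u then y x u else 1) * if r u x then y u x else 1) := by
  classical
  have : Fintype W := Fintype.ofFinite W
  rw [pairWeight_eq, pairWeight_eq, Fintype.prod_eq_mul_prod_subtype_ne _ x,
    Fintype.prod_eq_mul_prod_subtype_ne _ x, if_pos hx]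
  simp_rw [fun u : {w // w ≠ x} => Fintype.prod_eq_mul_prod_subtype_ne
    (fun w => if r u w then y u w else 1) x]
  rw [Finset.prod_mul_distrib, Finset.prod_mul_distrib,
    show ∀ a b c d : ℝ, a * b * (c * d) = a * d * (b * c) from fun _ _ _ _ => by ring]
  congr!

/-- Summing over the colors of one vertex. -/
theorem weightPolynomial_eval_of_sum (q : ℝ) (B : Setoid {w // w ≠ x} → ℝ)
    (hB : ∀ (k : ℕ) (c : {w // w ≠ x} → Fin k) [Fintype {w // w ≠ x}],
      ∑ t : Fin k, ∏ u, (if t = c u then y x u * y u x else 1) = k + B (Setoid.ker c)) :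
    (weightPolynomial y).eval q = y x x * ∑ s : Setoid {w // w ≠ x},
      pairWeight (fun u w : {w // w ≠ x} => y u w) s * (q + B s) *
        (descPochhammer ℝ (Nat.card (Quotient s))).eval q := by
  classical
  have : Fintype W := Fintype.ofFinite W
  set P : Setoid {w // w ≠ x} → ℝ := fun s => pairWeight (fun u w : {w // w ≠ x} => y u w) s with hP
  -- The color of `x` is summed out at positive integers; as a polynomial identity this extends to
  -- real `q`.
  have key : weightPolynomial y =
      C (y x x) * (X * partitionPolynomial P + partitionPolynomial fun s => P s * B s) := by
    refine polynomial_eq_of_eval_nat fun k _ => ?_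
    rw [weightPolynomial, partitionPolynomial_eval_natCast, eval_mul, eval_add, eval_mul, eval_C,
      eval_X, partitionPolynomial_eval_natCast, partitionPolynomial_eval_natCast, Finset.mul_sum,
      ← Finset.sum_add_distrib, Finset.mul_sum, ← (Equiv.funSplitAt x (Fin k)).symm.sum_comp,
      Fintype.sum_prod_type_right]
    refine Finset.sum_congr rfl fun c _ => ?_
    have h1 : ∀ t : Fin k, pairWeight y (Setoid.ker ((Equiv.funSplitAt x (Fin k)).symm (t, c))) =
        y x x * P (Setoid.ker c) * ∏ u, (if t = c u then y x u * y u x else 1) := by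
      intro t
      have hx : (Equiv.funSplitAt x (Fin k)).symm (t, c) x = t := by
        simp [Equiv.funSplitAt, Equiv.piSplitAt]
      have hu : ∀ u : {w // w ≠ x}, (Equiv.funSplitAt x (Fin k)).symm (t, c) u = c u := by
        intro u
        simp [Equiv.funSplitAt, Equiv.piSplitAt, u.2]
      rw [pairWeight_split x y _ (Setoid.refl' _ x)]
      congr 1
      · congr 2
        funext u w
        simp only [Setoid.ker_def, hu]
      · refine Finset.prod_congr rfl fun u _ => ?_
        simp only [Setoid.ker_def, hu, hx, eq_comm (b := t)]
        split_ifs <;> simp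
    simp only [h1]
    rw [← Finset.mul_sum, hB]
    ring
  rw [key, eval_mul, eval_add, eval_mul, eval_C, eval_X, partitionPolynomial_eval,
    partitionPolynomial_eval, Finset.mul_sum, ← Finset.sum_add_distrib]
  congr 1
  exact Finset.sum_congr rfl fun s _ => by ring

theorem weightPolynomial_eval_of_no_neighbor (q : ℝ) (h : ∀ u ≠ x, y x u * y u x = 1) :
    (weightPolynomial y).eval q =
      y x x * q * (weightPolynomial fun u w : {w // w ≠ x} => y u w).eval q := by
  rw [weightPolynomial_eval_of_sum x y q (fun _ => 0), weightPolynomial, partitionPolynomial_eval,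
    mul_assoc (y x x)]
  · congr 1
    rw [Finset.mul_sum]
    exact Finset.sum_congr rfl fun s _ => by ring
  · intro k c _
    have : ∀ t : Fin k, ∏ u, (if t = c u then y x u * y u x else 1) = 1 :=
      fun t => Finset.prod_eq_one fun u _ => by rw [h u u.2, ite_self]
    simp [this]

theorem weightPolynomial_eval_of_neighbor (q : ℝ) (a : {w // w ≠ x})
    (h : ∀ u : {w // w ≠ x}, u ≠ a → y x u * y u x = 1) :
    (weightPolynomial y).eval q = y x x * (q - 1 + y x a * y a x) *
      (weightPolynomial fun u w : {w // w ≠ x} => y u w).eval q := by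
  rw [weightPolynomial_eval_of_sum x y q (fun _ => y x a * y a x - 1), weightPolynomial,
    partitionPolynomial_eval, mul_assoc (y x x)]
  · congr 1
    rw [Finset.mul_sum]
    exact Finset.sum_congr rfl fun s _ => by ring
  · intro k c _
    have : ∀ t : Fin k, ∏ u, (if t = c u then y x u * y u x else 1) =
        1 + if t = c a then y x a * y a x - 1 else 0 := by
      intro t
      rw [Fintype.prod_eq_single a fun u hu => by rw [h u hu, ite_self]]
      split_ifs <;> ring
    simp only [this]
    rw [Finset.sum_add_distrib, Finset.sum_ite_eq' Finset.univ (c a)]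
    simp

/-- It suffices to change one ordered pair, since an edge weight is the product over both orders;
`y` need not stay symmetric. -/
theorem pairWeight_mul_ite (r : W → W → Prop) [DecidableRel r] [DecidableEq W] (a b : W) (η : ℝ) :
    pairWeight (fun u w => if u = a ∧ w = b then y u w * η else y u w) r =
      pairWeight y r * if r a b then η else 1 := by
  classical
  have : Fintype W := Fintype.ofFinite W
  rw [pairWeight_eq, pairWeight_eq]
  have : ∀ u w, (if r u w then (if u = a ∧ w = b then y u w * η else y u w) else 1) =
      (if r u w then y u w else 1) *
        (if u = a then (if w = b then (if r a b then η else 1) else 1) else 1) := by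
    intro u w
    by_cases h1 : u = a
    · subst h1
      by_cases h2 : w = b
      · subst h2
        split_ifs <;> simp_all
      · simp [h2]
    · simp [h1]
  simp only [this, Finset.prod_mul_distrib]
  congr 1
  rw [Finset.prod_eq_single a (fun u _ hu => by simp [hu]) (by simp)]
  simp

/-- Series reduction: with α, β the edge weights at `x`, the sum over its color is q - 1 + αβ if `a`
and `b` agree and q - 2 + α + β otherwise. The second value is factored out, and the ratio becomes a
weight on the pair. -/
theorem weightPolynomial_eval_of_neighbors [DecidableEq W] {q : ℝ} (a b : {w // w ≠ x})
    (hab : a ≠ b) (h : ∀ u : {w // w ≠ x}, u ≠ a → u ≠ b → y x u * y u x = 1)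
    (hq : q - 2 + y x a * y a x + y x b * y b x ≠ 0) :
    (weightPolynomial y).eval q = y x x * (q - 2 + y x a * y a x + y x b * y b x) *
      (weightPolynomial fun u w : {w // w ≠ x} => if u = a ∧ w = b then
        y u w * ((q - 1 + (y x a * y a x) * (y x b * y b x)) /
          (q - 2 + y x a * y a x + y x b * y b x)) else y u w).eval q := by
  classical
  set α := y x a * y a x with hα
  set β := y x b * y b x with hβ
  rw [weightPolynomial_eval_of_sum x y q
    (fun s => if s a b then α * β - 1 else α + β - 2), weightPolynomial,
    partitionPolynomial_eval, mul_assoc (y x x)]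
  · congr 1
    rw [Finset.mul_sum]
    refine Finset.sum_congr rfl fun s _ => ?_
    rw [pairWeight_mul_ite (fun u w : {w // w ≠ x} => y u w) s a b]
    split_ifs
    · field_simp
      ring
    · ring
  · intro k c _
    have h1 : ∀ t : Fin k, ∏ u, (if t = c u then y x u * y u x else 1) =
        (if t = c a then α else 1) * (if t = c b then β else 1) := by
      intro t
      rw [Fintype.prod_eq_mul a b hab fun u hu => by rw [h u hu.1 hu.2, ite_self]]
    simp only [h1]
    by_cases hc : c a = c b
    · have h2 : ∀ t : Fin k, (if t = c a then α else 1) * (if t = c b then β else 1) =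
          1 + if t = c a then α * β - 1 else 0 := by
        intro t
        rw [← hc]
        split_ifs <;> ring
      simp only [h2]
      rw [Finset.sum_add_distrib, Finset.sum_ite_eq' Finset.univ (c a),
        if_pos (show Setoid.ker c a b from hc)]
      simp
    · have h2 : ∀ t : Fin k, (if t = c a then α else 1) * (if t = c b then β else 1) =
          1 + (if t = c a then α - 1 else 0) + (if t = c b then β - 1 else 0) := by
        intro t
        split_ifs with h3 h4
        · exact absurd (h3.symm.trans h4) hc
        all_goals ring
      simp only [h2]
      rw [Finset.sum_add_distrib, Finset.sum_add_distrib, Finset.sum_ite_eq' Finset.univ (c a),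
        Finset.sum_ite_eq' Finset.univ (c b), if_neg (show ¬ Setoid.ker c a b from hc)]
      simp
      ring

end PartitionPolynomial

end SimpleGraph

/-! ### Positivity beyond 2 for quotients of drawn graphs -/

namespace SimpleGraph

section Positivity

/-- The quotient of a graph `Γ` by a group of automorphisms, seen as a map `φ`: no edge of `Γ` lies
in a fibre, and the automorphisms preserving `φ` are transitive on each fibre. -/
structure IsOrbitMap {V W : Type*} (Γ : SimpleGraph V) (φ : V → W) : Prop where
  surjective : Function.Surjective φ
  ne_of_adj : ∀ u v, Γ.Adj u v → φ u ≠ φ v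
  exists_perm : ∀ u v, φ u = φ v → ∃ σ : Equiv.Perm V,
    (∀ a b, Γ.Adj (σ a) (σ b) ↔ Γ.Adj a b) ∧ (∀ a, φ (σ a) = φ a) ∧ σ u = v

/-- `u` and `w` are joined in the quotient graph. -/
def QuotientAdj {V W : Type*} (Γ : SimpleGraph V) (φ : V → W) (u w : W) : Prop :=
  ∃ a b, φ a = u ∧ φ b = w ∧ Γ.Adj a b

theorem QuotientAdj.symm {V W : Type*} {Γ : SimpleGraph V} {φ : V → W} {u w : W}
    (h : QuotientAdj Γ φ u w) : QuotientAdj Γ φ w u := by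
  obtain ⟨a, b, ha, hb, hab⟩ := h
  exact ⟨b, a, hb, ha, hab.symm⟩

/-- Remove the vertices which `φ` maps to `x`, and join their neighbours in different fibres. -/
def suppressFiber {V W : Type*} (Γ : SimpleGraph V) (φ : V → W) (x : W) :
    SimpleGraph {v // φ v ≠ x} where
  Adj a b := Γ.Adj a b ∨ (φ a ≠ φ b ∧ ∃ v, φ v = x ∧ Γ.Adj v a ∧ Γ.Adj v b)
  symm := ⟨fun _ _ h => h.elim (fun h => .inl h.symm)
    fun ⟨h, v, hv, ha, hb⟩ => .inr ⟨h.symm, v, hv, hb, ha⟩⟩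
  loopless := ⟨fun _ h => h.elim (fun h => h.ne rfl) fun h => h.1 rfl⟩

/-- The map induced by `φ` outside the fibre of `x`. -/
def restrictFiber {V W : Type*} (φ : V → W) (x : W) (v : {v // φ v ≠ x}) : {w // w ≠ x} :=
  ⟨φ v, v.2⟩

variable {V W : Type*} {Γ : SimpleGraph V} {φ : V → W}

theorem IsOrbitMap.suppressFiber (h : IsOrbitMap Γ φ) (x : W) :
    IsOrbitMap (Γ.suppressFiber φ x) (restrictFiber φ x) where
  surjective := by
    rintro ⟨w, hw⟩
    obtain ⟨v, rfl⟩ := h.surjective w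
    exact ⟨⟨v, hw⟩, rfl⟩
  ne_of_adj u v huv heq := by
    have heq' : φ u = φ v := congrArg Subtype.val heq
    exact huv.elim (fun h1 => h.ne_of_adj _ _ h1 heq') fun h1 => h1.1 heq'
  exists_perm u v huv := by
    obtain ⟨σ, hσ, hφ, hv⟩ := h.exists_perm u v (congrArg Subtype.val huv)
    refine ⟨σ.subtypePerm fun a => by rw [hφ], fun a b => ?_, fun a => Subtype.ext (hφ a),
      Subtype.ext hv⟩
    change (Γ.Adj (σ a) (σ b) ∨ (φ (σ a) ≠ φ (σ b) ∧ ∃ v, φ v = x ∧ Γ.Adj v (σ a) ∧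
      Γ.Adj v (σ b))) ↔ (Γ.Adj a b ∨ (φ a ≠ φ b ∧ ∃ v, φ v = x ∧ Γ.Adj v a ∧ Γ.Adj v b))
    rw [hσ, hφ, hφ, σ.surjective.exists (p := fun v => φ v = x ∧ Γ.Adj v (σ a) ∧ Γ.Adj v (σ b))]
    simp only [hσ, hφ]

/-- Evaluations beyond `2` of the multivariate chromatic polynomial of the quotient of a graph
which can be drawn with all vertices on the outer boundary are positive. -/
theorem weightPolynomial_eval_pos [Finite V] [Finite W] (D : Nonempty Γ.OuterDrawing)
    (h : IsOrbitMap Γ φ) (y : W → W → ℝ) (hy : ∀ u w, 0 ≤ y u w)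
    (hy1 : ∀ u w, ¬ QuotientAdj Γ φ u w → y u w = 1) {q : ℝ} (hq : 2 < q) :
    0 < (weightPolynomial y).eval q := by
  induction hn : Nat.card W generalizing V W with
  | zero =>
    have : IsEmpty W := (Nat.card_eq_zero.1 hn).resolve_right fun h => h.not_finite ‹_›
    rw [weightPolynomial_of_isEmpty]
    simp
  | succ n ih =>
    classical
    have : Nonempty W := (Nat.card_pos_iff.1 (by omega)).1
    obtain ⟨w₀⟩ := this
    have : Nonempty V := ⟨(h.surjective w₀).choose⟩
    obtain ⟨v₀, a₀, b₀, hv₀⟩ := D.some.exists_degree_le_two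
    set x := φ v₀ with hx
    have hmove : ∀ v, φ v = x → ∃ σ : Equiv.Perm V, (∀ a b, Γ.Adj (σ a) (σ b) ↔ Γ.Adj a b) ∧
        (∀ a, φ (σ a) = φ a) ∧ σ v = v₀ := fun v hv => h.exists_perm v v₀ hv
    have hcard : Nat.card {w // w ≠ x} = n := by
      have : Fintype W := Fintype.ofFinite W
      rw [Nat.card_eq_fintype_card] at hn ⊢
      rw [Fintype.card_subtype_compl, Fintype.card_subtype_eq, hn]
      rfl
    -- Automorphisms preserving `φ` carry the degree bound from `v₀` to its whole fibre.
    have hdeg : ∀ v, ¬ φ v ≠ x → ∃ a b, ∀ z, Γ.Adj v z → z = a ∨ z = b := by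
      intro v hv
      obtain ⟨σ, hσ, -, hσv⟩ := hmove v (not_not.1 hv)
      refine ⟨σ.symm a₀, σ.symm b₀, fun z hz => ?_⟩
      rw [Equiv.eq_symm_apply, Equiv.eq_symm_apply]
      rw [← hσ, hσv] at hz
      exact hv₀ _ hz
    have D' : Nonempty (Γ.suppressFiber φ x).OuterDrawing := by
      refine D.some.exists_suppress _ (fun a b hab => ?_) hdeg
      rcases hab with h1 | ⟨-, v, hv, h2⟩
      · exact .inl h1
      · exact .inr ⟨v, not_not.2 hv, h2⟩
    have h' := h.suppressFiber x
    have hnbr : ∀ u, QuotientAdj Γ φ x u → ∃ b, φ b = u ∧ Γ.Adj v₀ b := by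
      rintro u ⟨a, b, ha, rfl, hab⟩
      obtain ⟨σ, hσ, hφ, hσa⟩ := hmove a ha
      exact ⟨σ b, hφ b, by rw [← hσa, hσ]; exact hab⟩
    have hnbr' : ∀ u, QuotientAdj Γ φ x u → u = φ a₀ ∨ u = φ b₀ := by
      intro u hu
      obtain ⟨b, rfl, hb⟩ := hnbr u hu
      exact (hv₀ b hb).imp (congrArg φ) (congrArg φ)
    have hxx : y x x = 1 := hy1 x x fun ⟨a, b, ha, hb, hab⟩ => h.ne_of_adj a b hab (ha.trans hb.symm)
    have hone : ∀ u, ¬ QuotientAdj Γ φ x u → y x u * y u x = 1 := by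
      intro u hu
      rw [hy1 x u hu, hy1 u x fun h => hu h.symm, one_mul]
    have hsub : ∀ u w : {w // w ≠ x},
        ¬ QuotientAdj (Γ.suppressFiber φ x) (restrictFiber φ x) u w → y u w = 1 := by
      rintro ⟨u, hu⟩ ⟨w, hw⟩ huw
      refine hy1 u w fun ⟨a, b, ha, hb, hab⟩ => huw ?_
      exact ⟨⟨a, by rwa [ha]⟩, ⟨b, by rwa [hb]⟩, Subtype.ext ha, Subtype.ext hb, .inl hab⟩
    -- The cases are zero, one or two neighbours of `x` in the quotient.
    by_cases h0 : ∀ u, ¬ QuotientAdj Γ φ x u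
    · rw [weightPolynomial_eval_of_no_neighbor x y q fun u _ => hone u (h0 u), hxx, one_mul]
      exact mul_pos (by linarith) (ih D' h' _ (fun _ _ => hy _ _) hsub hcard)
    push Not at h0
    obtain ⟨a, ha⟩ := h0
    have hne : ∀ u, QuotientAdj Γ φ x u → u ≠ x := by
      rintro u ⟨c, d, hc, hd, hcd⟩ rfl
      exact h.ne_of_adj c d hcd (hc.trans hd.symm)
    have hya := mul_nonneg (hy x a) (hy a x)
    by_cases h1 : ∀ u, u ≠ a → ¬ QuotientAdj Γ φ x u
    · rw [weightPolynomial_eval_of_neighbor x y q ⟨a, hne a ha⟩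
        fun u hu => hone u (h1 u fun h => hu (Subtype.ext h)), hxx, one_mul]
      exact mul_pos (by dsimp only; linarith) (ih D' h' _ (fun _ _ => hy _ _) hsub hcard)
    push Not at h1
    obtain ⟨b, hba, hb⟩ := h1
    have hyb := mul_nonneg (hy x b) (hy b x)
    have hκ : 0 < q - 2 + y x a * y a x + y x b * y b x := by linarith
    rw [weightPolynomial_eval_of_neighbors x y ⟨a, hne a ha⟩ ⟨b, hne b hb⟩
      (fun h => hba (congrArg Subtype.val h).symm) (fun u hua hub => hone u fun hu => ?_) hκ.ne',
      hxx, one_mul]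
    · refine mul_pos hκ (ih D' h' _ (fun u w => ?_) (fun u w huw => ?_) hcard)
      · split_ifs
        · exact mul_nonneg (hy _ _) (div_nonneg (by nlinarith) hκ.le)
        · exact hy _ _
      · rw [if_neg]
        · exact hsub u w huw
        · rintro ⟨rfl, rfl⟩
          -- The new weight sits on an edge of the new quotient: both neighbours of `x` lift to
          -- neighbours of `v₀`, which the suppression joins.
          obtain ⟨a', ha', hva⟩ := hnbr a ha
          obtain ⟨b', hb', hvb⟩ := hnbr b hb
          refine huw ⟨⟨a', by rw [ha']; exact hne a ha⟩, ⟨b', by rw [hb']; exact hne b hb⟩,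
            Subtype.ext ha', Subtype.ext hb', .inr ⟨?_, v₀, rfl, hva, hvb⟩⟩
          dsimp only
          rw [ha', hb']
          exact hba.symm
    · have hua' : (u : W) ≠ a := fun h => hua (Subtype.ext h)
      have hub' : (u : W) ≠ b := fun h => hub (Subtype.ext h)
      have e1 := hnbr' u hu
      have e2 := hnbr' a ha
      have e3 := hnbr' b hb
      grind

open Classical in
theorem weightPolynomial_quotientAdj_eval_pos [Finite V] [Finite W] (D : Nonempty Γ.OuterDrawing)
    (h : IsOrbitMap Γ φ) {q : ℝ} (hq : 2 < q) :
    0 < (weightPolynomial fun u w => if QuotientAdj Γ φ u w then 0 else 1).eval q :=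
  weightPolynomial_eval_pos D h _ (fun _ _ => by split_ifs <;> norm_num)
    (fun _ _ huw => if_neg huw) hq

end Positivity

/-! ### Fixed colorings and orbit counting -/

section Orbits

variable {V : Type*} {Γ : SimpleGraph V}

open Classical in
theorem chromaticPolynomial_eq_weightPolynomial [Finite V] :
    Γ.chromaticPolynomial = weightPolynomial fun u w => if QuotientAdj Γ id u w then 0 else 1 := by
  refine polynomial_eq_of_eval_nat fun k hk => ?_
  rw [chromaticPolynomial_eval _ k hk, weightPolynomial_indicator, Nat.cast_inj]
  exact Nat.card_congr
    { toFun := fun c => ⟨c, fun _ _ ⟨_, _, ha, hb, hab⟩ => c.valid (ha ▸ hb ▸ hab)⟩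
      invFun := fun c => Coloring.mk c.1 (fun {a b} hab => c.2 a b ⟨a, b, rfl, rfl, hab⟩)
      left_inv := fun _ => rfl
      right_inv := fun _ => rfl }

theorem isOrbitMap_id : IsOrbitMap Γ (id : V → V) where
  surjective := Function.surjective_id
  ne_of_adj _ _ h := h.ne
  exists_perm _ _ h := ⟨Equiv.refl V, fun _ _ => Iff.rfl, fun _ => rfl, h⟩

theorem chromaticPolynomial_eval_pos [Finite V] (D : Nonempty Γ.OuterDrawing) {q : ℝ}
    (hq : 2 < q) : 0 < Γ.chromaticPolynomial.eval q := by
  rw [chromaticPolynomial_eq_weightPolynomial]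
  exact weightPolynomial_quotientAdj_eval_pos D isOrbitMap_id hq

/-- The relation of being in the same orbit of an automorphism. -/
def cycleSetoid (g : Γ ≃g Γ) : Setoid V where
  r u v := ∃ n : ℤ, (g ^ n) u = v
  iseqv :=
    { refl := fun u => ⟨0, rfl⟩
      symm := by
        rintro u v ⟨n, rfl⟩
        refine ⟨-n, ?_⟩
        change (g ^ (-n) * g ^ n) u = u
        rw [← zpow_add, neg_add_cancel, zpow_zero]
        rfl
      trans := by
        rintro u v w ⟨n, rfl⟩ ⟨m, rfl⟩
        exact ⟨m + n, by rw [zpow_add]; rfl⟩ }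

theorem coloring_zpow_apply {α : Type*} {g : Γ ≃g Γ} {c : Γ.Coloring α} (hc : g • c = c) (n : ℤ)
    (v : V) : c ((g ^ n) v) = c v := by
  have h1 : g ∈ MulAction.stabilizer (Γ ≃g Γ) c := hc
  have h2 : g ^ (-n) • c = c := Subgroup.zpow_mem _ h1 (-n)
  have h3 := coloring_smul_apply (g ^ (-n)) c v
  rw [h2, zpow_neg, inv_inv] at h3
  exact h3.symm

theorem isOrbitMap_cycleSetoid {g : Γ ≃g Γ}
    (hg : ∀ u v, Γ.Adj u v → (Quotient.mk (cycleSetoid g) u) ≠ Quotient.mk _ v) :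
    IsOrbitMap Γ (Quotient.mk (cycleSetoid g)) where
  surjective := Quotient.mk_surjective
  ne_of_adj := hg
  exists_perm u v huv := by
    obtain ⟨n, hn⟩ := Quotient.exact huv
    refine ⟨(g ^ n).toEquiv, fun a b => (g ^ n).map_rel_iff, fun a => ?_, hn⟩
    exact (Quotient.sound (s := cycleSetoid g) ⟨n, rfl⟩).symm

/-- The number of colorings fixed by an automorphism is given by a polynomial which is
nonnegative beyond `2`. -/
theorem exists_polynomial_card_fixedBy [Finite V] (D : Nonempty Γ.OuterDrawing) (g : Γ ≃g Γ) :
    ∃ P : ℝ[X], (∀ k : ℕ, P.eval (k : ℝ) = Nat.card (MulAction.fixedBy (Γ.Coloring (Fin k)) g)) ∧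
      ∀ q, 2 < q → 0 ≤ P.eval q := by
  classical
  by_cases hg : ∀ u v, Γ.Adj u v → (Quotient.mk (cycleSetoid g) u) ≠ Quotient.mk _ v
  · refine ⟨weightPolynomial fun u w =>
      if QuotientAdj Γ (Quotient.mk (cycleSetoid g)) u w then 0 else 1, fun k => ?_, fun q hq =>
      (weightPolynomial_quotientAdj_eval_pos D (isOrbitMap_cycleSetoid hg) hq).le⟩
    rw [weightPolynomial_indicator, Nat.cast_inj]
    refine Nat.card_congr
      { toFun := fun c => ⟨Coloring.mk (fun v => c.1 (Quotient.mk _ v))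
            (fun {a b} hab => c.2 _ _ ⟨a, b, rfl, rfl, hab⟩), ?_⟩
        invFun := fun c => ⟨Quotient.lift c.1 ?_, ?_⟩
        left_inv := ?_
        right_inv := fun _ => rfl }
    · refine RelHom.ext fun v => ?_
      exact congrArg c.1 (Quotient.sound (s := cycleSetoid g) ⟨1, by
        rw [zpow_one]; exact g.apply_symm_apply v⟩)
    · rintro u v ⟨n, rfl⟩
      exact (coloring_zpow_apply c.2 n u).symm
    · rintro _ _ ⟨u, v, rfl, rfl, huv⟩
      exact c.1.valid huv
    · rintro ⟨c, hc⟩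
      refine Subtype.ext (funext fun x => ?_)
      induction x using Quotient.inductionOn with
      | h v => rfl
  -- A fixed coloring is constant on cycles of `g`, so an edge inside a cycle leaves none and the
  -- zero polynomial serves.
  · push Not at hg
    obtain ⟨u, v, huv, h⟩ := hg
    refine ⟨0, fun k => ?_, fun q _ => by simp⟩
    have : IsEmpty (MulAction.fixedBy (Γ.Coloring (Fin k)) g) := by
      refine ⟨fun c => ?_⟩
      obtain ⟨n, hn⟩ := Quotient.exact h
      refine c.1.valid huv ?_
      rw [← hn, coloring_zpow_apply c.2]
    simp

/-- In the orbit-counting average all terms are nonnegative beyond 2, and the identity contributes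
the chromatic polynomial, which is positive there. -/
theorem orbitalChromaticPolynomial_eval_pos [Finite V] (D : Nonempty Γ.OuterDrawing)
    (G : Subgroup (Γ ≃g Γ)) {q : ℝ} (hq : 2 < q) :
    0 < (Γ.orbitalChromaticPolynomial G).eval q := by
  classical
  have : Fintype V := Fintype.ofFinite V
  have : Finite (Γ ≃g Γ) := Finite.of_injective (fun g : Γ ≃g Γ => (g : V → V))
    (fun g h hgh => RelIso.ext fun v => congrFun hgh v)
  have : Fintype G := Fintype.ofFinite G
  choose P hP hP0 using fun g : G => exists_polynomial_card_fixedBy D g.1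
  have hG : (0 : ℝ) < Fintype.card G := by exact_mod_cast Fintype.card_pos
  have h1 : P 1 = Γ.chromaticPolynomial := by
    refine polynomial_eq_of_eval_nat fun k hk => ?_
    rw [hP, chromaticPolynomial_eval _ k hk, Nat.cast_inj]
    refine Nat.card_congr (Equiv.subtypeUnivEquiv fun c => ?_)
    exact one_smul (Γ ≃g Γ) c
  have h2 : Γ.orbitalChromaticPolynomial G = C (Fintype.card G : ℝ)⁻¹ * ∑ g, P g := by
    refine polynomial_eq_of_eval_nat fun k hk => ?_
    have : Fintype (MulAction.orbitRel.Quotient G (Γ.Coloring (Fin k))) := Fintype.ofFinite _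
    have hb := MulAction.sum_card_fixedBy_eq_card_orbits_mul_card_group G (Γ.Coloring (Fin k))
    rw [orbitalChromaticPolynomial_eval _ _ k hk, eval_mul, eval_C, eval_finsetSum,
      Nat.card_eq_fintype_card]
    have hP' : ∀ g : G, (P g).eval (k : ℝ) =
        Fintype.card (MulAction.fixedBy (Γ.Coloring (Fin k)) g) := by
      intro g
      rw [hP, ← Nat.card_eq_fintype_card]
      rfl
    simp only [hP']
    rw [← Nat.cast_sum, hb, Nat.cast_mul]
    field_simp
  rw [h2, eval_mul, eval_C, eval_finsetSum]
  refine mul_pos (inv_pos.2 hG) (Finset.sum_pos' (fun g _ => hP0 g q hq) ⟨1, Finset.mem_univ _, ?_⟩)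
  rw [h1]
  exact chromaticPolynomial_eval_pos D hq

end Orbits

end SimpleGraph

theorem theorem1p3 {V : Type*} [Finite V] (Γ : SimpleGraph V) (hΓ : Γ.IsOuterplanar)
    (hodd : ∃ (v : V) (c : Γ.Walk v v), c.IsCycle ∧ Odd c.length) (G : Subgroup (Γ ≃g Γ)) :
    IsGreatest {x : ℝ | Γ.chromaticPolynomial.IsRoot x} 2 ∧
      ∀ x : ℝ, (Γ.orbitalChromaticPolynomial G).IsRoot x → x ≤ 2 := by
  have D := hΓ.nonempty_outerDrawing
  refine ⟨⟨?_, fun x hx => ?_⟩, fun x hx => ?_⟩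
  · have hempty : IsEmpty (Γ.Coloring (Fin 2)) := by
      refine ⟨fun c => ?_⟩
      obtain ⟨v, w, -, hw⟩ := hodd
      exact Nat.not_even_iff_odd.2 hw (SimpleGraph.two_colorable_iff_forall_loop_even.1 ⟨c⟩ v w)
    have h2 := Γ.chromaticPolynomial_eval 2 (by norm_num)
    rw [Nat.card_of_isEmpty] at h2
    exact_mod_cast h2
  · by_contra! h
    exact (SimpleGraph.chromaticPolynomial_eval_pos D h).ne' hx
  · by_contra! h
    exact (SimpleGraph.orbitalChromaticPolynomial_eval_pos D G h).ne' hx
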